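/- Let $r\ge 1$, let $a$ be an integer prime to $r$, and let $\mu_r\subset\mathbb C^*$ be the group of $r$-th roots of unity. Let $$\tilde W^s_r=\Big\{((x,y,z,t),[p,q])\in\mathbb C^4\times\mathbb P^1 : xy-z^{2r}+t^2=0,\ \ \frac pq=\frac{x}{z^r-t}=\frac{z^r+t}{y}\Big\}$$ (the last equations meaning $p(z^r-t)=qx$ and $py=q(z^r+t)$), a smooth manifold on which $\xi\in\mu_r$ acts by $$\xi\cdot((x,y,z,t),[p,q])=((\xi^a x,\xi^{-a}y,\xi z,t),[\xi^a p,q]),$$ and let $W^s_r=\tilde W^s_r/\mu_r$. The cohomology $H^*(W^s_r)$ of this orbifold is the cohomology of the complex $\Omega^*_{\mu_r}(\tilde W^s_r)$ of $\mu_r$-invariant real differential forms on $\tilde W^s_r$; in particular $W^s_1=\tilde W^s_1$ and $H^*(W^s_1)$ is its de Rham cohomology. Write $((u,v,w,s),[m,n])$ for the points of $W^s_1$, and let $\xi\in\mu_r$ act on $W^s_1$ by $((\xi^a u,\xi^{-a}v,w,s),[\xi^a m,n])$. Let $\xi\in S^1$ act by the same formula on $W^s_1$ and by $((\xi^a x,\xi^{-a}y,z,t),[\xi^a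 p,q])$ on $\tilde W^s_r$. Let $$\pi:\tilde W^s_r\to W^s_1,\qquad ((x,y,z,t),[p,q])\mapsto((x,y,z^r,t),[p,q]).$$ Then: 1. $\pi$ is $\mu_r$-equivariant and $S^1$-equivariant, and it is an $r$-fold branched covering ramified over $\{w=0\}$: it is a covering with $r$-point fibres over $\{w\ne0\}$ and one-to-one over $\{w=0\}$. 2. For every $k$, pullback along $\pi$ induces an isomorphism $H^k(\Omega^*_{\mu_r}(W^s_1))\to H^k(\Omega^*_{\mu_r}(\tilde W^s_r))=H^k(W^s_r)$, and the inclusion of the invariant forms induces an isomorphism $H^k(\Omega^*_{\mu_r}(W^s_1))\to H^k(W^s_1)$. Hence there is an isomorphism $H^k(W^s_1)\cong H^k(W^s_r)$ which sends the class of each closed $\mu_r$-invariant $k$-form $\omega$ on $W^s_1$ to the class of $\pi^*\omega$. 3. $H^2(W^s_r)$ is a one-dimensional real vector space. -/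

import Mathlib

noncomputable section

open Set Topology Function
open scoped LinearAlgebra.Projectivization ContDiff

namespace DeRham

section Multilinear

variable {E F : Type*} [NormedAddCommGroup E] [NormedSpace ℝ E]
  [NormedAddCommGroup F] [NormedSpace ℝ F]

/-- Antisymmetrization of continuous multilinear maps, as a continuous linear map. -/
def altCLM (E : Type*) [NormedAddCommGroup E] [NormedSpace ℝ E] (k : ℕ) :
    ContinuousMultilinearMap ℝ (fun _ : Fin k => E) ℝ →L[ℝ] E [⋀^Fin k]→L[ℝ] ℝ :=
  LinearMap.mkContinuous
    { toFun := fun f => ContinuousMultilinearMap.alternatization f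
      map_add' := fun f g => by simp
      map_smul' := fun c f => by
        ext v
        simp [ContinuousMultilinearMap.alternatization_apply_apply, Finset.mul_sum,
          mul_smul_comm] }
    (k.factorial : ℝ) (fun f => by
      refine ContinuousAlternatingMap.opNorm_le_bound _ (by positivity) fun v => ?_
      change ‖ContinuousMultilinearMap.alternatization f v‖ ≤ _
      rw [ContinuousMultilinearMap.alternatization_apply_apply]
      refine (norm_sum_le _ _).trans ?_
      have hb : ∀ σ ∈ (Finset.univ : Finset (Equiv.Perm (Fin k))),
          ‖Equiv.Perm.sign σ • f (v ∘ σ)‖ ≤ ‖f‖ * ∏ i, ‖v i‖ := by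
        intro σ _
        have h1 : ‖Equiv.Perm.sign σ • f (v ∘ σ)‖ = ‖f (v ∘ σ)‖ := by
          rcases Int.units_eq_one_or (Equiv.Perm.sign σ) with h | h <;> simp [h]
        rw [h1]
        refine (f.le_opNorm _).trans (le_of_eq ?_)
        congr 1
        exact Equiv.prod_comp σ (fun i => ‖v i‖)
      refine (Finset.sum_le_card_nsmul _ _ _ hb).trans (le_of_eq ?_)
      simp [Fintype.card_perm, mul_assoc])

theorem altCLM_apply (k : ℕ) (f : E [⋀^Fin k]→L[ℝ] ℝ) :
    altCLM E k f.toContinuousMultilinearMap = (k.factorial : ℝ) • f := by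
  ext v
  change ContinuousMultilinearMap.alternatization f.toContinuousMultilinearMap v = _
  rw [ContinuousMultilinearMap.alternatization_apply_apply]
  have : ∀ σ ∈ (Finset.univ : Finset (Equiv.Perm (Fin k))),
      Equiv.Perm.sign σ • f.toContinuousMultilinearMap (v ∘ σ) = f v := by
    intro σ _
    have h := f.toAlternatingMap.map_perm v σ
    change Equiv.Perm.sign σ • f (v ∘ σ) = f v
    have h' : f (v ∘ σ) = Equiv.Perm.sign σ • f v := h
    rw [h', smul_smul, Int.units_mul_self, one_smul]
  rw [Finset.sum_congr rfl this]
  simp [Fintype.card_perm]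

/-- Pulling back an alternating map along a linear map is smooth in both arguments. -/
theorem contDiff_compCLM (k : ℕ) : ContDiff ℝ ∞
    (fun q : (F [⋀^Fin k]→L[ℝ] ℝ) × (E →L[ℝ] F) => q.1.compContinuousLinearMap q.2) := by
  have key : (fun q : (F [⋀^Fin k]→L[ℝ] ℝ) × (E →L[ℝ] F) => q.1.compContinuousLinearMap q.2)
      = fun q => ((k.factorial : ℝ)⁻¹) • altCLM E k
        ((ContinuousMultilinearMap.compContinuousLinearMapContinuousMultilinear ℝ
          (fun _ : Fin k => E) (fun _ : Fin k => F) ℝ (fun _ => q.2))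
          (ContinuousAlternatingMap.toContinuousMultilinearMapCLM ℝ q.1)) := by
    funext q
    have := altCLM_apply k (q.1.compContinuousLinearMap q.2)
    have h2 : (ContinuousMultilinearMap.compContinuousLinearMapContinuousMultilinear ℝ
          (fun _ : Fin k => E) (fun _ : Fin k => F) ℝ (fun _ => q.2))
          (ContinuousAlternatingMap.toContinuousMultilinearMapCLM ℝ q.1)
        = (q.1.compContinuousLinearMap q.2).toContinuousMultilinearMap := by
      ext v; rfl
    rw [h2, this, smul_smul, inv_mul_cancel₀ (by positivity), one_smul]
  rw [key]
  refine ContDiff.const_smul _ ((altCLM E k).contDiff.comp ?_)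
  have hpi : ContDiff ℝ ∞ (fun (q : (F [⋀^Fin k]→L[ℝ] ℝ) × (E →L[ℝ] F)) (_ : Fin k) => q.2) :=
    contDiff_pi.2 fun _ => contDiff_snd
  have h0 : ContDiff ℝ ∞ (fun g : Fin k → E →L[ℝ] F =>
      ContinuousMultilinearMap.compContinuousLinearMapContinuousMultilinear ℝ
        (fun _ : Fin k => E) (fun _ : Fin k => F) ℝ g) := ContinuousMultilinearMap.contDiff _
  have h1 := h0.comp hpi
  have h2 : ContDiff ℝ ∞ (fun q : (F [⋀^Fin k]→L[ℝ] ℝ) × (E →L[ℝ] F) =>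
      ContinuousAlternatingMap.toContinuousMultilinearMapCLM ℝ q.1) :=
    ((ContinuousAlternatingMap.toContinuousMultilinearMapCLM ℝ :
      (F [⋀^Fin k]→L[ℝ] ℝ) →L[ℝ] _).contDiff (n := ∞)).comp
      (contDiff_fst (E := F [⋀^Fin k]→L[ℝ] ℝ) (F := E →L[ℝ] F))
  exact ContDiff.clm_apply h1 h2

end Multilinear

/-- A smooth manifold structure on the space `X`, modelled on `E`: an atlas of inverse charts
`param i : E → X`, each a homeomorphism of the whole of `E` onto an open subset of `X`, jointly
surjective, with smooth transition maps. -/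
structure SmoothAtlas (E X : Type) [NormedAddCommGroup E] [NormedSpace ℝ E]
    [TopologicalSpace X] where
  /-- index set of the atlas -/
  ι : Type
  /-- the inverse charts -/
  param : ι → E → X
  isOpenEmbedding : ∀ i, IsOpenEmbedding (param i)
  cover : ∀ x, ∃ i, x ∈ range (param i)
  smooth : ∀ i j, ContDiffOn ℝ ∞ (invFun (param j) ∘ param i) (param i ⁻¹' range (param j))

variable {E F G X Y Z : Type} [NormedAddCommGroup E] [NormedSpace ℝ E]
  [NormedAddCommGroup F] [NormedSpace ℝ F] [NormedAddCommGroup G] [NormedSpace ℝ G]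
  [TopologicalSpace X] [TopologicalSpace Y] [TopologicalSpace Z]

/-- The expression of `f : X → Y` in the charts `i` and `j`; it is meaningful on
`locDom A B f i j`. -/
def locRep (A : SmoothAtlas E X) (B : SmoothAtlas F Y) (f : X → Y) (i : A.ι) (j : B.ι) : E → F :=
  invFun (B.param j) ∘ f ∘ A.param i

/-- The points of the chart `i` that `f` sends into the chart `j`. -/
def locDom (A : SmoothAtlas E X) (B : SmoothAtlas F Y) (f : X → Y) (i : A.ι) (j : B.ι) : Set E :=
  A.param i ⁻¹' (f ⁻¹' range (B.param j))

/-- Smooth maps between manifolds. -/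
structure SmoothMap (A : SmoothAtlas E X) (B : SmoothAtlas F Y) where
  toFun : X → Y
  continuous_toFun : Continuous toFun
  smooth_toFun : ∀ i j, ContDiffOn ℝ ∞ (locRep A B toFun i j) (locDom A B toFun i j)

instance (A : SmoothAtlas E X) (B : SmoothAtlas F Y) : CoeFun (SmoothMap A B) (fun _ => X → Y) :=
  ⟨SmoothMap.toFun⟩

/-- The identity map. -/
def SmoothMap.id (A : SmoothAtlas E X) : SmoothMap A A where
  toFun := fun x => x
  continuous_toFun := continuous_id
  smooth_toFun := A.smooth

section Local

variable {A : SmoothAtlas E X} {B : SmoothAtlas F Y} {C : SmoothAtlas G Z}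

theorem param_locRep {f : X → Y} {i : A.ι} {j : B.ι} {v : E} (hv : v ∈ locDom A B f i j) :
    B.param j (locRep A B f i j v) = f (A.param i v) :=
  invFun_eq hv

theorem locRep_eq_of_eq {f : X → Y} {i : A.ι} {j : B.ι} {v : E} {w : F}
    (h : f (A.param i v) = B.param j w) : locRep A B f i j v = w := by
  change invFun (B.param j) (f (A.param i v)) = w
  rw [h]
  exact leftInverse_invFun (B.isOpenEmbedding j).injective w

theorem isOpen_locDom {f : X → Y} (hf : Continuous f) (i : A.ι) (j : B.ι) :
    IsOpen (locDom A B f i j) :=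
  ((B.isOpenEmbedding j).isOpen_range.preimage hf).preimage (A.isOpenEmbedding i).continuous

theorem SmoothMap.contDiffAt (f : SmoothMap A B) {i : A.ι} {j : B.ι} {v : E}
    (hv : v ∈ locDom A B f i j) : ContDiffAt ℝ ∞ (locRep A B f i j) v :=
  (f.smooth_toFun i j).contDiffAt ((isOpen_locDom f.continuous_toFun i j).mem_nhds hv)

/-- The chart expression of a composition. -/
theorem locRep_comp {f : X → Y} (hf : Continuous f) {g : Y → Z}
    {i : A.ι} {j : B.ι} {l : C.ι} {v : E} (hv : v ∈ locDom A B f i j) :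
    locRep A C (fun x => g (f x)) i l =ᶠ[𝓝 v] locRep B C g j l ∘ locRep A B f i j := by
  filter_upwards [(isOpen_locDom hf i j).mem_nhds hv] with u hu
  change invFun (C.param l) (g (f (A.param i u))) = invFun (C.param l) (g (B.param j _))
  rw [param_locRep hu]

theorem mem_locDom_comp {f : X → Y} {g : Y → Z} {i : A.ι} {j : B.ι} {l : C.ι} {v : E}
    (hv : v ∈ locDom A B f i j) (hv' : v ∈ locDom A C (fun x => g (f x)) i l) :
    locRep A B f i j v ∈ locDom B C g j l := by
  change g (B.param j _) ∈ range (C.param l)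
  rw [param_locRep hv]
  exact hv'

/-- The chain rule for chart expressions. -/
theorem fderiv_locRep_comp (f : SmoothMap A B) (g : SmoothMap B C)
    {i : A.ι} {j : B.ι} {l : C.ι} {v : E}
    (hv : v ∈ locDom A B f i j) (hv' : v ∈ locDom A C (fun x => g (f x)) i l) :
    fderiv ℝ (locRep A C (fun x => g (f x)) i l) v =
      (fderiv ℝ (locRep B C g j l) (locRep A B f i j v)).comp (fderiv ℝ (locRep A B f i j) v) := by
  rw [(locRep_comp f.continuous_toFun hv).fderiv_eq]
  exact fderiv_comp _ ((g.contDiffAt (mem_locDom_comp hv hv')).differentiableAt (by simp))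
    ((f.contDiffAt hv).differentiableAt (by simp))

/-- A map which is given by a smooth map from each chart to some chart is smooth. -/
def SmoothMap.ofCharts (f : X → Y) (hf : Continuous f) (j : A.ι → B.ι) (φ : A.ι → E → F)
    (hφ : ∀ i, ContDiff ℝ ∞ (φ i)) (h : ∀ i v, f (A.param i v) = B.param (j i) (φ i v)) :
    SmoothMap A B where
  toFun := f
  continuous_toFun := hf
  smooth_toFun := by
    intro i l
    have e : locRep A B f i l = (invFun (B.param l) ∘ B.param (j i)) ∘ φ i := by
      funext v
      change invFun (B.param l) (f (A.param i v)) = _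
      rw [h]; rfl
    rw [e]
    refine (B.smooth (j i) l).comp (hφ i).contDiffOn fun v hv => ?_
    change B.param (j i) (φ i v) ∈ range (B.param l)
    rw [← h]
    exact hv

end Local

/-- Composition of smooth maps. -/
def SmoothMap.comp {A : SmoothAtlas E X} {B : SmoothAtlas F Y} {C : SmoothAtlas G Z}
    (g : SmoothMap B C) (f : SmoothMap A B) : SmoothMap A C where
  toFun := fun x => g (f x)
  continuous_toFun := g.continuous_toFun.comp f.continuous_toFun
  smooth_toFun := by
    intro i l v hv
    obtain ⟨j, hj⟩ := B.cover (f (A.param i v))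
    have hv1 : v ∈ locDom A B f i j := hj
    refine ContDiffAt.contDiffWithinAt ?_
    refine ContDiffAt.congr_of_eventuallyEq ?_
      (locRep_comp f.continuous_toFun (g := g) hv1)
    exact (g.contDiffAt (mem_locDom_comp hv1 hv)).comp v (f.contDiffAt hv1)

/-- The pullback of the `k`-form `α` on `F` along `φ : E → F`. -/
def pull {k : ℕ} (φ : E → F) (α : F → F [⋀^Fin k]→L[ℝ] ℝ) (v : E) : E [⋀^Fin k]→L[ℝ] ℝ :=
  (α (φ v)).compContinuousLinearMap (fderiv ℝ φ v)

theorem pull_contDiffAt {k : ℕ} {φ : E → F} {α : F → F [⋀^Fin k]→L[ℝ] ℝ} {v : E}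
    (hφ : ContDiffAt ℝ ∞ φ v) (hα : ContDiff ℝ ∞ α) : ContDiffAt ℝ ∞ (pull φ α) v := by
  have h1 : ContDiffAt ℝ ∞ (fun u => (α (φ u), fderiv ℝ φ u)) v :=
    (hα.contDiffAt.comp v hφ).prodMk (hφ.fderiv_right (by simp))
  exact (contDiff_compCLM k).contDiffAt.comp v h1

/-- Smooth real differential `k`-forms on the manifold: families `α i` of smooth forms in the
charts which are related by pullback along the transition maps. -/
def formSubmodule (A : SmoothAtlas E X) (k : ℕ) : Submodule ℝ (A.ι → E → E [⋀^Fin k]→L[ℝ] ℝ) where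
  carrier := {α | (∀ i, ContDiff ℝ ∞ (α i)) ∧
    ∀ i j, ∀ v ∈ A.param i ⁻¹' range (A.param j),
      α i v = pull (invFun (A.param j) ∘ A.param i) (α j) v}
  add_mem' := by
    rintro α η ⟨h1, h2⟩ ⟨h3, h4⟩
    refine ⟨fun i => (h1 i).add (h3 i), fun i j v hv => ?_⟩
    change α i v + η i v = _
    rw [h2 i j v hv, h4 i j v hv]
    rfl
  zero_mem' := ⟨fun i => contDiff_const, fun i j v hv => rfl⟩
  smul_mem' := by
    rintro c α ⟨h1, h2⟩
    refine ⟨fun i => (h1 i).const_smul c, fun i j v hv => ?_⟩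
    change c • α i v = _
    rw [h2 i j v hv]
    rfl

/-- The real vector space of smooth differential `k`-forms, see `formSubmodule`. -/
def Form (A : SmoothAtlas E X) (k : ℕ) : Type := formSubmodule A k

instance (A : SmoothAtlas E X) (k : ℕ) : AddCommGroup (Form A k) :=
  Submodule.addCommGroup (formSubmodule A k)

instance (A : SmoothAtlas E X) (k : ℕ) : Module ℝ (Form A k) :=
  Submodule.module (formSubmodule A k)

theorem minSm : minSmoothness ℝ 2 ≤ (∞ : WithTop ℕ∞) := by
  rw [minSmoothness_of_isRCLikeNormedField]
  exact WithTop.coe_le_coe.2 (le_top : (2 : ℕ∞) ≤ ⊤)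

theorem form_differentiableAt {A : SmoothAtlas E X} {k : ℕ} (α : Form A k) (i : A.ι) (v : E) :
    DifferentiableAt ℝ (α.1 i) v :=
  (α.2.1 i).contDiffAt.differentiableAt (by simp)

/-- The exterior derivative, computed in each chart. -/
def d (A : SmoothAtlas E X) (k : ℕ) : Form A k →ₗ[ℝ] Form A (k + 1) where
  toFun α := ⟨fun i => extDeriv (α.1 i), by
    refine ⟨fun i => ?_, fun i j v hv => ?_⟩
    · have h := (α.2.1 i).fderiv_right (m := ∞) (by simp)
      exact (ContinuousAlternatingMap.alternatizeUncurryFinCLM ℝ E ℝ).contDiff.comp h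
    · have hv' : v ∈ locDom A A (SmoothMap.id A) i j := hv
      have hU := (isOpen_locDom (SmoothMap.id A).continuous_toFun i j).mem_nhds hv'
      have e : α.1 i =ᶠ[𝓝 v] fun u =>
          (α.1 j ((invFun (A.param j) ∘ A.param i) u)).compContinuousLinearMap
            (fderiv ℝ (invFun (A.param j) ∘ A.param i) u) := by
        filter_upwards [hU] with u hu
        exact α.2.2 i j u hu
      change extDeriv (α.1 i) v = _
      rw [e.extDeriv_eq]
      exact extDeriv_pullback (form_differentiableAt α j _) ((SmoothMap.id A).contDiffAt hv') minSm⟩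
  map_add' α η := by
    apply Subtype.ext
    funext i v
    exact extDeriv_add (form_differentiableAt α i v) (form_differentiableAt η i v)
  map_smul' c α := by
    apply Subtype.ext
    funext i v
    exact extDeriv_smul c (α.1 i)

theorem d_d (A : SmoothAtlas E X) (k : ℕ) (α : Form A k) : d A (k + 1) (d A k α) = 0 := by
  apply Subtype.ext
  funext i
  exact extDeriv_extDeriv (α.2.1 i) minSm

section Pullback

variable {A : SmoothAtlas E X} {B : SmoothAtlas F Y} {C : SmoothAtlas G Z}

/-- The components of the pullback of a form. The chart of the target may be chosen arbitrarily,
see `pullbackFun_eq`. -/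
def pullbackFun (f : SmoothMap A B) {k : ℕ} (α : Form B k) (i : A.ι) (v : E) :
    E [⋀^Fin k]→L[ℝ] ℝ :=
  pull (locRep A B f i (B.cover (f (A.param i v))).choose)
    (α.1 (B.cover (f (A.param i v))).choose) v

theorem pull_indep (f : SmoothMap A B) {k : ℕ} (α : Form B k) {i : A.ι} {j l : B.ι} {v : E}
    (hj : v ∈ locDom A B f i j) (hl : v ∈ locDom A B f i l) :
    pull (locRep A B f i j) (α.1 j) v = pull (locRep A B f i l) (α.1 l) v := by
  have hl' : v ∈ locDom A B (fun x => (SmoothMap.id B) (f x)) i l := hl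
  have hm : locRep A B f i j v ∈ locDom B B (SmoothMap.id B) j l := mem_locDom_comp hj hl'
  have h1 := α.2.2 j l (locRep A B f i j v) hm
  have h2 := fderiv_locRep_comp f (SmoothMap.id B) hj hl'
  have h3 := (locRep_comp f.continuous_toFun (g := SmoothMap.id B) (l := l) hj).eq_of_nhds
  unfold pull at h1 ⊢
  rw [h1]
  have h2' : fderiv ℝ (locRep A B f i l) v = _ := h2
  have h3' : locRep A B f i l v = _ := h3
  rw [h2', h3']
  rfl

theorem pullbackFun_eq (f : SmoothMap A B) {k : ℕ} (α : Form B k) {i : A.ι} {j : B.ι} {v : E}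
    (hj : v ∈ locDom A B f i j) :
    pullbackFun f α i v = pull (locRep A B f i j) (α.1 j) v :=
  pull_indep f α (B.cover (f (A.param i v))).choose_spec hj

theorem pullbackFun_eventuallyEq (f : SmoothMap A B) {k : ℕ} (α : Form B k) {i : A.ι} {j : B.ι}
    {v : E} (hj : v ∈ locDom A B f i j) :
    pullbackFun f α i =ᶠ[𝓝 v] pull (locRep A B f i j) (α.1 j) := by
  filter_upwards [(isOpen_locDom f.continuous_toFun i j).mem_nhds hj] with u hu
  exact pullbackFun_eq f α hu

/-- The pullback `f^*α` of differential forms. -/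
def pullback (f : SmoothMap A B) (k : ℕ) : Form B k →ₗ[ℝ] Form A k where
  toFun α := ⟨pullbackFun f α, by
    refine ⟨fun i => contDiff_iff_contDiffAt.2 fun v => ?_, fun i i' v hv => ?_⟩
    · obtain ⟨j, hj⟩ := B.cover (f (A.param i v))
      have hj' : v ∈ locDom A B f i j := hj
      exact (pull_contDiffAt (f.contDiffAt hj') (α.2.1 j)).congr_of_eventuallyEq
        (pullbackFun_eventuallyEq f α hj')
    · obtain ⟨j, hj⟩ := B.cover (f (A.param i v))
      have hj' : v ∈ locDom A B f i j := hj
      have hv' : v ∈ locDom A A (SmoothMap.id A) i i' := hv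
      have hjc : v ∈ locDom A B (fun x => f ((SmoothMap.id A) x)) i j := hj
      have hm := mem_locDom_comp hv' hjc
      have h2 := fderiv_locRep_comp (SmoothMap.id A) f hv' hjc
      have h3 := (locRep_comp (SmoothMap.id A).continuous_toFun
        (g := f) (l := j) hv').eq_of_nhds
      rw [pullbackFun_eq f α hj']
      change _ = (pullbackFun f α i' (locRep A A (SmoothMap.id A) i i' v)).compContinuousLinearMap
        (fderiv ℝ (locRep A A (SmoothMap.id A) i i') v)
      rw [pullbackFun_eq f α hm]
      unfold pull
      have h2' : fderiv ℝ (locRep A B f i j) v = _ := h2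
      have h3' : locRep A B f i j v = _ := h3
      rw [h2', h3']
      rfl⟩
  map_add' α η := by
    apply Subtype.ext
    funext i v
    rfl
  map_smul' c α := by
    apply Subtype.ext
    funext i v
    rfl

theorem pullback_apply (f : SmoothMap A B) {k : ℕ} (α : Form B k) {i : A.ι} {j : B.ι} {v : E}
    (hj : v ∈ locDom A B f i j) :
    (pullback f k α).1 i v = pull (locRep A B f i j) (α.1 j) v :=
  pullbackFun_eq f α hj

theorem d_pullback (f : SmoothMap A B) (k : ℕ) (α : Form B k) :
    d A k (pullback f k α) = pullback f (k + 1) (d B k α) := by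
  apply Subtype.ext
  funext i v
  obtain ⟨j, hj⟩ := B.cover (f (A.param i v))
  have hj' : v ∈ locDom A B f i j := hj
  rw [pullback_apply f (d B k α) hj']
  change extDeriv (pullbackFun f α i) v = _
  rw [(pullbackFun_eventuallyEq f α hj').extDeriv_eq]
  exact extDeriv_pullback (form_differentiableAt α j _) (f.contDiffAt hj') minSm

theorem pullback_id (k : ℕ) (α : Form A k) : pullback (SmoothMap.id A) k α = α := by
  apply Subtype.ext
  funext i v
  have hi : v ∈ locDom A A (SmoothMap.id A) i i := mem_range_self v
  rw [pullback_apply _ α hi]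
  exact (α.2.2 i i v (mem_range_self v)).symm

theorem pullback_comp (g : SmoothMap B C) (f : SmoothMap A B) (k : ℕ) (α : Form C k) :
    pullback (g.comp f) k α = pullback f k (pullback g k α) := by
  apply Subtype.ext
  funext i v
  obtain ⟨j, hj⟩ := B.cover (f (A.param i v))
  have hj' : v ∈ locDom A B f i j := hj
  obtain ⟨l, hl⟩ := C.cover (g (f (A.param i v)))
  have hl' : v ∈ locDom A C (fun x => g (f x)) i l := hl
  have hl'' : v ∈ locDom A C (g.comp f) i l := hl
  have hm := mem_locDom_comp hj' hl'
  rw [pullback_apply _ α hl'', pullback_apply f (pullback g k α) hj']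
  change _ = ((pullback g k α).1 j (locRep A B f i j v)).compContinuousLinearMap _
  rw [pullback_apply g α hm]
  have h2 := fderiv_locRep_comp f g hj' hl'
  have h3 := (locRep_comp f.continuous_toFun (g := g) (l := l) hj').eq_of_nhds
  have h2' : fderiv ℝ (locRep A C (g.comp f) i l) v = _ := h2
  have h3' : locRep A C (g.comp f) i l v = _ := h3
  unfold pull
  rw [h2', h3']
  rfl

theorem pullback_congr {f g : SmoothMap A B} (h : ∀ x, f x = g x) (k : ℕ) :
    pullback f k = pullback g k := by
  have : f = g := by
    cases f; cases g
    congr 1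
    exact funext h
  rw [this]

end Pullback

/-- The forms invariant under every map of the set `S`; for `S = ∅` these are all the forms. -/
def invForm (A : SmoothAtlas E X) (S : Set (SmoothMap A A)) (k : ℕ) : Submodule ℝ (Form A k) where
  carrier := {α | ∀ g ∈ S, pullback g k α = α}
  add_mem' := fun h1 h2 g hg => by rw [map_add, h1 g hg, h2 g hg]
  zero_mem' := fun _ _ => map_zero _
  smul_mem' := fun c _ h g hg => by rw [map_smul, h g hg]

/-- Closed `S`-invariant `k`-forms. -/
def cocycles (A : SmoothAtlas E X) (S : Set (SmoothMap A A)) (k : ℕ) : Submodule ℝ (Form A k) :=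
  invForm A S k ⊓ LinearMap.ker (d A k)

/-- The `k`-forms `dη` with `η` an `S`-invariant form of degree `k - 1` (only `0` for `k = 0`). -/
def coboundaries (A : SmoothAtlas E X) (S : Set (SmoothMap A A)) :
    (k : ℕ) → Submodule ℝ (Form A k)
  | 0 => ⊥
  | k + 1 => (invForm A S k).map (d A k)

theorem coboundaries_le_cocycles (A : SmoothAtlas E X) (S : Set (SmoothMap A A)) (k : ℕ) :
    coboundaries A S k ≤ cocycles A S k := by
  cases k with
  | zero => exact bot_le
  | succ k =>
    rintro _ ⟨η, hη, rfl⟩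
    refine ⟨fun g hg => ?_, d_d A k η⟩
    rw [← d_pullback, hη g hg]

/-- The cohomology of the complex of `S`-invariant differential forms. -/
abbrev H (A : SmoothAtlas E X) (S : Set (SmoothMap A A)) (k : ℕ) : Type :=
  cocycles A S k ⧸ (coboundaries A S k).submoduleOf (cocycles A S k)

/-- The cohomology class of a closed invariant form. -/
def cls (A : SmoothAtlas E X) (S : Set (SmoothMap A A)) (k : ℕ) : cocycles A S k →ₗ[ℝ] H A S k :=
  Submodule.mkQ _

section Induced

variable {A : SmoothAtlas E X} {B : SmoothAtlas F Y}

/-- `f` intertwines each map of `S` with some map of `T`. -/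
def Intertwines (f : SmoothMap A B) (S : Set (SmoothMap A A)) (T : Set (SmoothMap B B)) : Prop :=
  ∀ g ∈ S, ∃ g' ∈ T, ∀ x, f (g x) = g' (f x)

theorem pullback_mem_invForm {f : SmoothMap A B} {S : Set (SmoothMap A A)}
    {T : Set (SmoothMap B B)} (h : Intertwines f S T) {k : ℕ} {α : Form B k}
    (hα : α ∈ invForm B T k) : pullback f k α ∈ invForm A S k := by
  intro g hg
  obtain ⟨g', hg', hc⟩ := h g hg
  rw [← pullback_comp, pullback_congr (f := f.comp g) (g := g'.comp f) hc, pullback_comp,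
    hα g' hg']

theorem pullback_mem_cocycles {f : SmoothMap A B} {S : Set (SmoothMap A A)}
    {T : Set (SmoothMap B B)} (h : Intertwines f S T) {k : ℕ} {α : Form B k}
    (hα : α ∈ cocycles B T k) : pullback f k α ∈ cocycles A S k := by
  refine ⟨pullback_mem_invForm h hα.1, ?_⟩
  change d A k (pullback f k α) = 0
  rw [d_pullback, show d B k α = 0 from hα.2, map_zero]

theorem pullback_mem_coboundaries {f : SmoothMap A B} {S : Set (SmoothMap A A)}
    {T : Set (SmoothMap B B)} (h : Intertwines f S T) {k : ℕ} {α : Form B k}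
    (hα : α ∈ coboundaries B T k) : pullback f k α ∈ coboundaries A S k := by
  cases k with
  | zero =>
    have h0 : α = 0 := hα
    rw [h0, map_zero]
    exact Submodule.zero_mem _
  | succ k =>
    obtain ⟨η, hη, rfl⟩ := hα
    exact ⟨pullback f k η, pullback_mem_invForm h hη, d_pullback f k η⟩

/-- The map `[α] ↦ [f^*α]` from the cohomology of the `T`-invariant forms on `Y` to that of the
`S`-invariant forms on `X`. -/
def cohMap (f : SmoothMap A B) {S : Set (SmoothMap A A)} {T : Set (SmoothMap B B)}
    (h : Intertwines f S T) (k : ℕ) : H B T k →ₗ[ℝ] H A S k :=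
  Submodule.mapQ _ _
    ((pullback f k).restrict (p := cocycles B T k) (q := cocycles A S k)
      fun _ hα => pullback_mem_cocycles h hα)
    fun _ hα => pullback_mem_coboundaries h hα

theorem cohMap_cls (f : SmoothMap A B) {S : Set (SmoothMap A A)} {T : Set (SmoothMap B B)}
    (h : Intertwines f S T) (k : ℕ) (α : cocycles B T k) :
    cohMap f h k (cls B T k α) =
      cls A S k ⟨pullback f k α.1, pullback_mem_cocycles h α.2⟩ := rfl

/-- The map `[α] ↦ [α]` from the cohomology of the `T`-invariant forms to that of all forms. -/
def forget (B : SmoothAtlas F Y) (T : Set (SmoothMap B B)) (k : ℕ) : H B T k →ₗ[ℝ] H B ∅ k :=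
  cohMap (SmoothMap.id B) (S := ∅) (T := T) (fun _ hg => absurd hg (notMem_empty _)) k

theorem forget_cls (B : SmoothAtlas F Y) (T : Set (SmoothMap B B)) (k : ℕ) (α : cocycles B T k) :
    forget B T k (cls B T k α) =
      cls B ∅ k ⟨α.1, ⟨fun _ hg => absurd hg (notMem_empty _), α.2.2⟩⟩ := by
  have h : pullback (SmoothMap.id B) k α.1 = α.1 := pullback_id k α.1
  change cls B ∅ k _ = _
  congr 1
  exact Subtype.ext h

end Induced

end DeRham

namespace SmallResolution

open DeRham

/-- The complex projective line, with homogeneous coordinates `[p, q] = [v 0, v 1]`. -/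
abbrev P1 : Type := ℙ ℂ (Fin 2 → ℂ)

/-- The quotient topology on the projective line. -/
instance : TopologicalSpace P1 :=
  inferInstanceAs (TopologicalSpace (Quotient (projectivizationSetoid ℂ (Fin 2 → ℂ))))

theorem isQuotientMap_mk : IsQuotientMap (Projectivization.mk' ℂ (V := Fin 2 → ℂ)) :=
  isQuotientMap_quot_mk

/-- The affine coordinate `v i / v j` on the projective line. -/
def ratio (i j : Fin 2) : P1 → ℂ :=
  Projectivization.lift (fun v => v.1 i / v.1 j) (by
    rintro ⟨a, ha⟩ ⟨b, hb⟩ t rfl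
    have ht : t ≠ 0 := fun h => ha (by simp [h])
    simp [mul_div_mul_left _ _ ht])

/-- The locus `v j ≠ 0`. -/
def affine (j : Fin 2) : Set P1 :=
  {L | Projectivization.lift (fun v : {v : Fin 2 → ℂ // v ≠ 0} => v.1 j ≠ 0) (by
    rintro ⟨a, ha⟩ ⟨b, hb⟩ t rfl
    have ht : t ≠ 0 := fun h => ha (by simp [h])
    simp [ht]) L}

theorem isOpen_affine (j : Fin 2) : IsOpen (affine j) := by
  rw [← isQuotientMap_mk.isOpen_preimage]
  have : Continuous fun v : {v : Fin 2 → ℂ // v ≠ 0} => v.1 j :=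
    (continuous_apply j).comp continuous_subtype_val
  exact isOpen_ne.preimage this

theorem continuousOn_ratio (i j : Fin 2) : ContinuousOn (ratio i j) (affine j) := by
  rw [isQuotientMap_mk.continuousOn_isOpen_iff (isOpen_affine j)]
  have h : ∀ i, Continuous fun v : {v : Fin 2 → ℂ // v ≠ 0} => v.1 i :=
    fun i => (continuous_apply i).comp continuous_subtype_val
  exact (h i).continuousOn.div (h j).continuousOn fun v hv => hv

/-- The equations `x y - z ^ (2 r) + t ^ 2 = 0` and `p / q = x / (z ^ r - t) = (z ^ r + t) / y`,
the latter with denominators cleared. -/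
def Incident (r : ℕ) (x y z t : ℂ) (L : P1) : Prop :=
  x * y - z ^ (2 * r) + t ^ 2 = 0 ∧
    ∀ (v : Fin 2 → ℂ) (hv : v ≠ 0), Projectivization.mk ℂ v hv = L →
      v 0 * (z ^ r - t) = v 1 * x ∧ v 0 * y = v 1 * (z ^ r + t)

theorem incident_mk {r : ℕ} {x y z t : ℂ} {v : Fin 2 → ℂ} {hv : v ≠ 0} :
    Incident r x y z t (Projectivization.mk ℂ v hv) ↔ x * y - z ^ (2 * r) + t ^ 2 = 0 ∧
      v 0 * (z ^ r - t) = v 1 * x ∧ v 0 * y = v 1 * (z ^ r + t) := by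
  refine ⟨fun h => ⟨h.1, h.2 v hv rfl⟩, fun h => ⟨h.1, fun w hw e => ?_⟩⟩
  obtain ⟨c, rfl⟩ := (Projectivization.mk_eq_mk_iff' ℂ _ _ hw hv).1 e
  simp only [Pi.smul_apply, smul_eq_mul]
  exact ⟨by linear_combination c * h.2.1, by linear_combination c * h.2.2⟩

/-- The small resolution of the hypersurface `x y - z ^ (2 r) + t ^ 2 = 0`: the points
`((x, y, z, t), [p, q])` of `ℂ⁴ × ℙ¹` with `p / q = x / (z ^ r - t) = (z ^ r + t) / y`. -/
def W (r : ℕ) : Type :=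
  {P : (ℂ × ℂ × ℂ × ℂ) × P1 // Incident r P.1.1 P.1.2.1 P.1.2.2.1 P.1.2.2.2 P.2}

instance (r : ℕ) : TopologicalSpace (W r) :=
  inferInstanceAs (TopologicalSpace {P : (ℂ × ℂ × ℂ × ℂ) × P1 //
    Incident r P.1.1 P.1.2.1 P.1.2.2.1 P.1.2.2.2 P.2})

/-- The third coordinate (`z` on `W r`, `w` on `W 1`). -/
def W.z {r : ℕ} (P : W r) : ℂ := P.1.1.2.2.1

theorem continuous_coords (r : ℕ) :
    Continuous (fun P : W r => (P.1 : (ℂ × ℂ × ℂ × ℂ) × P1)) := continuous_subtype_val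

/-- The inverse chart onto `q ≠ 0`, with coordinates `(p / q, y, z)`. -/
def paramP (r : ℕ) (c : ℂ × ℂ × ℂ) : W r :=
  ⟨((c.1 * (2 * c.2.2 ^ r - c.1 * c.2.1), c.2.1, c.2.2, c.1 * c.2.1 - c.2.2 ^ r),
    Projectivization.mk ℂ ![c.1, 1] (fun h => one_ne_zero (congrFun h 1))), by
    rw [incident_mk]
    simp only [Matrix.cons_val_zero, Matrix.cons_val_one]
    refine ⟨?_, ?_, ?_⟩ <;> ring⟩

/-- The inverse chart onto `p ≠ 0`, with coordinates `(q / p, x, z)`. -/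
def paramQ (r : ℕ) (c : ℂ × ℂ × ℂ) : W r :=
  ⟨((c.2.1, c.1 * (2 * c.2.2 ^ r - c.1 * c.2.1), c.2.2, c.2.2 ^ r - c.1 * c.2.1),
    Projectivization.mk ℂ ![1, c.1] (fun h => one_ne_zero (congrFun h 0))), by
    rw [incident_mk]
    simp only [Matrix.cons_val_zero, Matrix.cons_val_one]
    refine ⟨?_, ?_, ?_⟩ <;> ring⟩

theorem continuous_mk {X : Type*} [TopologicalSpace X] {f : X → Fin 2 → ℂ} (hf : Continuous f)
    (h : ∀ x, f x ≠ 0) : Continuous fun x => (Projectivization.mk ℂ (f x) (h x) : P1) :=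
  isQuotientMap_mk.continuous.comp (hf.subtype_mk h)

theorem continuous_paramP (r : ℕ) : Continuous (paramP r) := by
  refine Continuous.subtype_mk (Continuous.prodMk (by fun_prop) ?_) _
  refine continuous_mk (f := fun c : ℂ × ℂ × ℂ => ![c.1, 1]) ?_ _
  refine continuous_pi fun i => ?_
  fin_cases i
  · exact continuous_fst
  · exact continuous_const

theorem continuous_paramQ (r : ℕ) : Continuous (paramQ r) := by
  refine Continuous.subtype_mk (Continuous.prodMk (by fun_prop) ?_) _
  refine continuous_mk (f := fun c : ℂ × ℂ × ℂ => ![1, c.1]) ?_ _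
  refine continuous_pi fun i => ?_
  fin_cases i
  · exact continuous_const
  · exact continuous_fst

/-- The chart `(p / q, y, z)` as a homeomorphism. -/
def homeoP (r : ℕ) : OpenPartialHomeomorph (ℂ × ℂ × ℂ) (W r) where
  toFun := paramP r
  invFun P := (ratio 0 1 P.1.2, P.1.1.2.1, P.1.1.2.2.1)
  source := univ
  target := {P | P.1.2 ∈ affine 1}
  map_source' := fun c _ => (one_ne_zero : (1 : ℂ) ≠ 0)
  map_target' := fun _ _ => mem_univ _
  left_inv' := fun c _ => by
    refine Prod.ext ?_ rfl
    change c.1 / 1 = c.1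
    simp
  right_inv' := by
    rintro ⟨⟨⟨x, y, z, t⟩, L⟩, hP⟩ hL
    induction L using Projectivization.ind with
    | h v hv =>
    have hv1 : v 1 ≠ 0 := hL
    obtain ⟨h1, h2, h3⟩ := incident_mk.1 hP
    simp only at h1 h2 h3
    refine Subtype.ext (Prod.ext (Prod.ext ?_ (Prod.ext rfl (Prod.ext rfl ?_))) ?_)
    · change v 0 / v 1 * (2 * z ^ r - v 0 / v 1 * y) = x
      field_simp
      linear_combination v 1 * h2 - v 0 * h3
    · change v 0 / v 1 * y - z ^ r = t
      field_simp
      linear_combination h3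
    · refine (Projectivization.mk_eq_mk_iff' ℂ _ _ _ _).2 ⟨(v 1)⁻¹, ?_⟩
      funext i
      fin_cases i
      · change (v 1)⁻¹ * v 0 = v 0 / v 1
        field_simp
      · change (v 1)⁻¹ * v 1 = 1
        field_simp
  open_source := isOpen_univ
  open_target := (isOpen_affine 1).preimage (continuous_snd.comp (continuous_coords r))
  continuousOn_toFun := (continuous_paramP r).continuousOn
  continuousOn_invFun := by
    have h := continuous_coords r
    refine ContinuousOn.prodMk ?_ (Continuous.continuousOn (by fun_prop))
    exact (continuousOn_ratio 0 1).comp (continuous_snd.comp h).continuousOn fun _ hP => hP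

/-- The chart `(q / p, x, z)` as a homeomorphism. -/
def homeoQ (r : ℕ) : OpenPartialHomeomorph (ℂ × ℂ × ℂ) (W r) where
  toFun := paramQ r
  invFun P := (ratio 1 0 P.1.2, P.1.1.1, P.1.1.2.2.1)
  source := univ
  target := {P | P.1.2 ∈ affine 0}
  map_source' := fun c _ => (one_ne_zero : (1 : ℂ) ≠ 0)
  map_target' := fun _ _ => mem_univ _
  left_inv' := fun c _ => by
    refine Prod.ext ?_ rfl
    change c.1 / 1 = c.1
    simp
  right_inv' := by
    rintro ⟨⟨⟨x, y, z, t⟩, L⟩, hP⟩ hL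
    induction L using Projectivization.ind with
    | h v hv =>
    have hv1 : v 0 ≠ 0 := hL
    obtain ⟨h1, h2, h3⟩ := incident_mk.1 hP
    simp only at h1 h2 h3
    refine Subtype.ext (Prod.ext (Prod.ext rfl (Prod.ext ?_ (Prod.ext rfl ?_))) ?_)
    · change v 1 / v 0 * (2 * z ^ r - v 1 / v 0 * x) = y
      field_simp
      linear_combination v 1 * h2 - v 0 * h3
    · change z ^ r - v 1 / v 0 * x = t
      field_simp
      linear_combination h2
    · refine (Projectivization.mk_eq_mk_iff' ℂ _ _ _ _).2 ⟨(v 0)⁻¹, ?_⟩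
      funext i
      fin_cases i
      · change (v 0)⁻¹ * v 0 = 1
        field_simp
      · change (v 0)⁻¹ * v 1 = v 1 / v 0
        field_simp
  open_source := isOpen_univ
  open_target := (isOpen_affine 0).preimage (continuous_snd.comp (continuous_coords r))
  continuousOn_toFun := (continuous_paramQ r).continuousOn
  continuousOn_invFun := by
    have h := continuous_coords r
    refine ContinuousOn.prodMk ?_ (Continuous.continuousOn (by fun_prop))
    exact (continuousOn_ratio 1 0).comp (continuous_snd.comp h).continuousOn fun _ hP => hP

/-- The two inverse charts of `W r`. -/
def param (r : ℕ) : Bool → ℂ × ℂ × ℂ → W r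
  | false => paramP r
  | true => paramQ r

theorem isOpenEmbedding_param (r : ℕ) : ∀ i, IsOpenEmbedding (param r i)
  | false => (homeoP r).isOpenEmbedding rfl
  | true => (homeoQ r).isOpenEmbedding rfl

/-- The transition map between the two charts, in either direction. -/
def trans (r : ℕ) (c : ℂ × ℂ × ℂ) : ℂ × ℂ × ℂ :=
  (c.1⁻¹, c.1 * (2 * c.2.2 ^ r - c.1 * c.2.1), c.2.2)

theorem paramP_eq (r : ℕ) {c : ℂ × ℂ × ℂ} (h : c.1 ≠ 0) : paramP r c = paramQ r (trans r c) := by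
  obtain ⟨s, u, z⟩ := c
  have h : s ≠ 0 := h
  refine Subtype.ext (Prod.ext (Prod.ext rfl (Prod.ext ?_ (Prod.ext rfl ?_))) ?_)
  · change u = s⁻¹ * (2 * z ^ r - s⁻¹ * (s * (2 * z ^ r - s * u)))
    field_simp
    ring
  · change s * u - z ^ r = z ^ r - s⁻¹ * (s * (2 * z ^ r - s * u))
    field_simp
    ring
  · refine (Projectivization.mk_eq_mk_iff' ℂ _ _ _ _).2 ⟨s, ?_⟩
    funext i
    fin_cases i
    · change s * 1 = s
      ring
    · change s * s⁻¹ = 1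
      field_simp

theorem paramQ_eq (r : ℕ) {c : ℂ × ℂ × ℂ} (h : c.1 ≠ 0) : paramQ r c = paramP r (trans r c) := by
  obtain ⟨s, u, z⟩ := c
  have h : s ≠ 0 := h
  refine Subtype.ext (Prod.ext (Prod.ext ?_ (Prod.ext rfl (Prod.ext rfl ?_))) ?_)
  · change u = s⁻¹ * (2 * z ^ r - s⁻¹ * (s * (2 * z ^ r - s * u)))
    field_simp
    ring
  · change z ^ r - s * u = s⁻¹ * (s * (2 * z ^ r - s * u)) - z ^ r
    field_simp
    ring
  · refine (Projectivization.mk_eq_mk_iff' ℂ _ _ _ _).2 ⟨s, ?_⟩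
    funext i
    fin_cases i
    · change s * s⁻¹ = 1
      field_simp
    · change s * 1 = s
      ring

theorem paramP_mem (r : ℕ) {c : ℂ × ℂ × ℂ} : paramP r c ∈ range (paramQ r) ↔ c.1 ≠ 0 := by
  refine ⟨?_, fun h => ⟨_, (paramP_eq r h).symm⟩⟩
  rintro ⟨c', h⟩
  have : paramQ r c' ∈ {P : W r | P.1.2 ∈ affine 0} := (one_ne_zero : (1 : ℂ) ≠ 0)
  rw [h] at this
  exact this

theorem paramQ_mem (r : ℕ) {c : ℂ × ℂ × ℂ} : paramQ r c ∈ range (paramP r) ↔ c.1 ≠ 0 := by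
  refine ⟨?_, fun h => ⟨_, (paramQ_eq r h).symm⟩⟩
  rintro ⟨c', h⟩
  have : paramP r c' ∈ {P : W r | P.1.2 ∈ affine 1} := (one_ne_zero : (1 : ℂ) ≠ 0)
  rw [h] at this
  exact this

theorem contDiffOn_trans (r : ℕ) : ContDiffOn ℝ ∞ (trans r) {c | c.1 ≠ 0} := by
  refine ContDiffOn.prodMk (contDiff_fst.contDiffOn.inv fun c hc => hc) ?_
  exact ContDiff.contDiffOn (by fun_prop)

/-- The smooth manifold structure of `W r`. -/
def atlas (r : ℕ) : SmoothAtlas (ℂ × ℂ × ℂ) (W r) where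
  ι := Bool
  param := param r
  isOpenEmbedding := isOpenEmbedding_param r
  cover := by
    rintro ⟨⟨⟨x, y, z, t⟩, L⟩, hP⟩
    induction L using Projectivization.ind with
    | h v hv =>
    by_cases h : v 1 = 0
    · have h0 : v 0 ≠ 0 := fun h0 => hv (by funext i; fin_cases i <;> simp [h, h0])
      exact ⟨true, _, (homeoQ r).right_inv (x := ⟨⟨⟨x, y, z, t⟩, _⟩, hP⟩) h0⟩
    · exact ⟨false, _, (homeoP r).right_inv (x := ⟨⟨⟨x, y, z, t⟩, _⟩, hP⟩) h⟩
  smooth := by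
    have hs : ∀ i, invFun (param r i) ∘ param r i = fun c => c := fun i =>
      funext (leftInverse_invFun (isOpenEmbedding_param r i).injective)
    rintro (_ | _) (_ | _)
    · rw [hs]; exact contDiff_id.contDiffOn
    · have e : param r false ⁻¹' range (param r true) = {c | c.1 ≠ 0} := by
        ext c; exact paramP_mem r
      rw [e]
      refine (contDiffOn_trans r).congr fun c hc => ?_
      change invFun (param r true) (paramP r c) = _
      rw [paramP_eq r hc]
      exact congrFun (hs true) _
    · have e : param r true ⁻¹' range (param r false) = {c | c.1 ≠ 0} := by
        ext c; exact paramQ_mem r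
      rw [e]
      refine (contDiffOn_trans r).congr fun c hc => ?_
      change invFun (param r false) (paramQ r c) = _
      rw [paramQ_eq r hc]
      exact congrFun (hs false) _
    · rw [hs]; exact contDiff_id.contDiffOn

/-- The underlying map of the branched covering `(x, y, z, t, [p, q]) ↦ (x, y, z ^ r, t, [p, q])`
from `W r` to `W 1`. -/
def projFun (r : ℕ) (P : W r) : W 1 :=
  ⟨((P.1.1.1, P.1.1.2.1, P.1.1.2.2.1 ^ r, P.1.1.2.2.2), P.1.2), by
    obtain ⟨h1, h2⟩ := P.2
    refine ⟨?_, fun v hv e => ?_⟩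
    · rw [← h1]; ring
    · rw [pow_one]; exact h2 v hv e⟩

theorem continuous_projFun (r : ℕ) : Continuous (projFun r) := by
  have h := continuous_coords r
  exact Continuous.subtype_mk (by fun_prop) _

/-- The branched covering `(x, y, z, t, [p, q]) ↦ (x, y, z ^ r, t, [p, q])`; it is
`(s, u, z) ↦ (s, u, z ^ r)` in both charts. -/
def proj (r : ℕ) : SmoothMap (atlas r) (atlas 1) :=
  SmoothMap.ofCharts (projFun r) (continuous_projFun r) (fun i => i)
    (fun _ c => (c.1, c.2.1, c.2.2 ^ r)) (fun _ => by fun_prop) (by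
      rintro (_ | _) c
      · refine Subtype.ext (Prod.ext (Prod.ext ?_ (Prod.ext rfl (Prod.ext rfl ?_))) rfl)
        · change _ = c.1 * (2 * (c.2.2 ^ r) ^ 1 - c.1 * c.2.1)
          rw [pow_one]; rfl
        · change _ = c.1 * c.2.1 - (c.2.2 ^ r) ^ 1
          rw [pow_one]; rfl
      · refine Subtype.ext (Prod.ext (Prod.ext rfl (Prod.ext ?_ (Prod.ext rfl ?_))) rfl)
        · change _ = c.1 * (2 * (c.2.2 ^ r) ^ 1 - c.1 * c.2.1)
          rw [pow_one]; rfl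
        · change _ = (c.2.2 ^ r) ^ 1 - c.1 * c.2.1
          rw [pow_one]; rfl)

/-- The linear map `(p, q) ↦ (b p, q)`. -/
def diag (b : ℂˣ) : (Fin 2 → ℂ) →ₗ[ℂ] (Fin 2 → ℂ) where
  toFun v := ![b * v 0, v 1]
  map_add' v w := by funext i; fin_cases i <;> simp [mul_add]
  map_smul' c v := by funext i; fin_cases i <;> simp [mul_left_comm]

theorem diag_injective (b : ℂˣ) : Injective (diag b) := by
  intro v w h
  have h0 : (b : ℂ) * v 0 = b * w 0 := congrFun h 0
  have h1 : v 1 = w 1 := congrFun h 1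
  funext i
  fin_cases i
  · exact mul_left_cancel₀ b.ne_zero h0
  · exact h1

/-- The map `[p, q] ↦ [b p, q]` of the projective line. -/
def rotate (b : ℂˣ) : P1 → P1 := Projectivization.map (diag b) (diag_injective b)

theorem continuous_rotate (b : ℂˣ) : Continuous (rotate b) := by
  rw [isQuotientMap_mk.continuous_iff]
  have h : Continuous fun v : {v : Fin 2 → ℂ // v ≠ 0} => diag b v.1 :=
    (LinearMap.continuous_of_finiteDimensional (diag b)).comp continuous_subtype_val
  exact continuous_mk h fun v hv => v.2 (diag_injective b (hv.trans (map_zero (diag b)).symm))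

/-- The underlying map of `act`. -/
def actFun (r : ℕ) (b c : ℂˣ) (hc : c ^ r = 1) (P : W r) : W r :=
  ⟨((b * P.1.1.1, (b⁻¹ : ℂˣ) * P.1.1.2.1, c * P.1.1.2.2.1, P.1.1.2.2.2), rotate b P.1.2), by
    obtain ⟨⟨⟨x, y, z, t⟩, L⟩, hP⟩ := P
    induction L using Projectivization.ind with
    | h v hv =>
    obtain ⟨h1, h2, h3⟩ := incident_mk.1 hP
    simp only at h1 h2 h3
    have hc' : (c : ℂ) ^ r = 1 := by
      rw [← Units.val_pow_eq_pow_val, hc, Units.val_one]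
    have hb : (b : ℂ) * ((b⁻¹ : ℂˣ) : ℂ) = 1 := by simp
    have hz : ((c : ℂ) * z) ^ r = z ^ r := by rw [mul_pow, hc', one_mul]
    have hz2 : ((c : ℂ) * z) ^ (2 * r) = z ^ (2 * r) := by
      rw [mul_comm 2 r, pow_mul, hz, ← pow_mul]
    change Incident r _ _ _ _ (rotate b (Projectivization.mk ℂ v hv))
    rw [rotate, Projectivization.map_mk, incident_mk]
    change _ ∧ b * v 0 * _ = v 1 * _ ∧ b * v 0 * _ = v 1 * _
    simp only [hz, hz2]
    refine ⟨?_, ?_, ?_⟩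
    · linear_combination h1 + x * y * hb
    · linear_combination (b : ℂ) * h2
    · linear_combination h3 + v 0 * y * hb⟩

theorem continuous_actFun (r : ℕ) (b c : ℂˣ) (hc : c ^ r = 1) : Continuous (actFun r b c hc) := by
  have h := continuous_coords r
  have h2 := continuous_rotate b
  exact Continuous.subtype_mk (by fun_prop) _

/-- The diffeomorphism `(x, y, z, t, [p, q]) ↦ (b x, b⁻¹ y, c z, t, [b p, q])` of `W r`, where
`c ^ r = 1`. -/
def act (r : ℕ) (b c : ℂˣ) (hc : c ^ r = 1) : SmoothMap (atlas r) (atlas r) :=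
  SmoothMap.ofCharts (actFun r b c hc) (continuous_actFun r b c hc) (fun i => i)
    (fun i e => match i with
      | false => (b * e.1, (b⁻¹ : ℂˣ) * e.2.1, c * e.2.2)
      | true => ((b⁻¹ : ℂˣ) * e.1, b * e.2.1, c * e.2.2))
    (by rintro (_ | _) <;> fun_prop) (by
      have hc' : (c : ℂ) ^ r = 1 := by
        rw [← Units.val_pow_eq_pow_val, hc, Units.val_one]
      have hb : (b : ℂ) * ((b⁻¹ : ℂˣ) : ℂ) = 1 := by simp
      rintro (_ | _) ⟨s, u, z⟩
      · have hz : ((c : ℂ) * z) ^ r = z ^ r := by rw [mul_pow, hc', one_mul]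
        refine Subtype.ext (Prod.ext (Prod.ext ?_ (Prod.ext rfl (Prod.ext rfl ?_))) ?_)
        · change b * (s * (2 * z ^ r - s * u)) =
            b * s * (2 * (c * z) ^ r - b * s * ((b⁻¹ : ℂˣ) * u))
          rw [hz]
          linear_combination b * s ^ 2 * u * hb
        · change s * u - z ^ r = b * s * ((b⁻¹ : ℂˣ) * u) - (c * z) ^ r
          rw [hz]
          linear_combination - s * u * hb
        · refine (Projectivization.mk_eq_mk_iff' ℂ _ _ _ _).2 ⟨1, ?_⟩
          funext i
          fin_cases i
          · exact one_mul _
          · exact one_mul _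
      · have hz : ((c : ℂ) * z) ^ r = z ^ r := by rw [mul_pow, hc', one_mul]
        refine Subtype.ext (Prod.ext (Prod.ext rfl (Prod.ext ?_ (Prod.ext rfl ?_))) ?_)
        · change (b⁻¹ : ℂˣ) * (s * (2 * z ^ r - s * u)) =
            (b⁻¹ : ℂˣ) * s * (2 * (c * z) ^ r - (b⁻¹ : ℂˣ) * s * (b * u))
          rw [hz]
          linear_combination ((b⁻¹ : ℂˣ) : ℂ) * s ^ 2 * u * hb
        · change z ^ r - s * u = (c * z) ^ r - (b⁻¹ : ℂˣ) * s * (b * u)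
          rw [hz]
          linear_combination s * u * hb
        · refine (Projectivization.mk_eq_mk_iff' ℂ _ _ _ _).2 ⟨b, ?_⟩
          funext i
          fin_cases i
          · rfl
          · change (b : ℂ) * ((b⁻¹ : ℂˣ) * s) = s
            linear_combination s * hb)

/-- The action of the `r`-th root of unity `ξ` on `W r`:
`(x, y, z, t, [p, q]) ↦ (ξ ^ a x, ξ ^ (-a) y, ξ z, t, [ξ ^ a p, q])`. -/
def muAct (r : ℕ) (a : ℤ) (ξ : rootsOfUnity r ℂ) : SmoothMap (atlas r) (atlas r) :=
  act r (ξ.1 ^ a) ξ.1 ξ.2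

/-- The action of `ξ ∈ ℂˣ` (in particular of a root of unity or of a point of the unit circle)
which does not move the third coordinate:
`(x, y, z, t, [p, q]) ↦ (ξ ^ a x, ξ ^ (-a) y, z, t, [ξ ^ a p, q])`. -/
def circleAct (r : ℕ) (a : ℤ) (ξ : ℂˣ) : SmoothMap (atlas r) (atlas r) :=
  act r (ξ ^ a) 1 (one_pow r)

/-- The group `μ_r` acting on `W r`. -/
def muCover (r : ℕ) (a : ℤ) : Set (SmoothMap (atlas r) (atlas r)) := range (muAct r a)

/-- The group `μ_r` acting on `W 1`, by
`(u, v, w, s, [m, n]) ↦ (ξ ^ a u, ξ ^ (-a) v, w, s, [ξ ^ a m, n])`. -/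
def muBase (r : ℕ) (a : ℤ) : Set (SmoothMap (atlas 1) (atlas 1)) :=
  range fun ξ : rootsOfUnity r ℂ => circleAct 1 a ξ.1

theorem proj_muAct (r : ℕ) (a : ℤ) (ξ : rootsOfUnity r ℂ) (P : W r) :
    proj r (muAct r a ξ P) = circleAct 1 a ξ.1 (proj r P) := by
  have h : ((ξ.1 : ℂˣ) : ℂ) ^ r = 1 := by
    rw [← Units.val_pow_eq_pow_val, (mem_rootsOfUnity r ξ.1).1 ξ.2, Units.val_one]
  refine Subtype.ext (Prod.ext (Prod.ext rfl (Prod.ext rfl (Prod.ext ?_ rfl))) rfl)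
  change (((ξ.1 : ℂˣ) : ℂ) * P.1.1.2.2.1) ^ r = ((1 : ℂˣ) : ℂ) * P.1.1.2.2.1 ^ r
  rw [mul_pow, h, Units.val_one]

theorem proj_intertwines (r : ℕ) (a : ℤ) :
    Intertwines (proj r) (muCover r a) (muBase r a) := by
  rintro _ ⟨ξ, rfl⟩
  exact ⟨_, ⟨ξ, rfl⟩, proj_muAct r a ξ⟩

/-- `H^k(W^s_r)`, the de Rham cohomology of the orbifold `W^s_r = W r / μ_r`: the cohomology of the
complex of `μ_r`-invariant forms on `W r`. -/
abbrev HOrb (r : ℕ) (a : ℤ) (k : ℕ) : Type := H (atlas r) (muCover r a) k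

/-- For `r = 1` the group is trivial and every form is invariant. -/
theorem invForm_muCover_one (a : ℤ) (k : ℕ) : invForm (atlas 1) (muCover 1 a) k = ⊤ := by
  refine eq_top_iff.2 fun η _ => ?_
  rintro _ ⟨ξ, rfl⟩
  have h1 : ξ.1 = 1 := by simpa using (mem_rootsOfUnity 1 ξ.1).1 ξ.2
  refine (congrArg (fun f => f η) (pullback_congr (g := SmoothMap.id (atlas 1)) ?_ k)).trans
    (pullback_id k η)
  rintro ⟨⟨⟨x, y, z, t⟩, L⟩, hP⟩
  induction L using Projectivization.ind with
  | h v hv =>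
  have hz : ξ.1 ^ a = 1 := by rw [h1, one_zpow]
  refine Subtype.ext (Prod.ext (Prod.ext ?_ (Prod.ext ?_ (Prod.ext ?_ rfl))) ?_)
  · change ((ξ.1 ^ a : ℂˣ) : ℂ) * x = x
    simp [hz]
  · change (((ξ.1 ^ a)⁻¹ : ℂˣ) : ℂ) * y = y
    simp [hz]
  · change (ξ.1 : ℂ) * z = z
    simp [h1]
  · refine (Projectivization.mk_eq_mk_iff' ℂ _ _ _ _).2 ⟨1, ?_⟩
    funext i
    fin_cases i
    · change (1 : ℂ) * v 0 = ((ξ.1 ^ a : ℂˣ) : ℂ) * v 0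
      simp [hz]
    · exact one_mul _

/-- `H^k(W^s_1)`, the de Rham cohomology of the manifold `W^s_1 = W 1`. -/
abbrev HBase (k : ℕ) : Type := H (atlas 1) ∅ k

/-- The cohomology of the complex of `μ_r`-invariant forms on `W^s_1`. -/
abbrev HBaseInv (r : ℕ) (a : ℤ) (k : ℕ) : Type := H (atlas 1) (muBase r a) k

/-- The map `[ω] ↦ [π^*ω]` induced by the branched covering `π : W r → W 1` on the cohomologies of
the complexes of `μ_r`-invariant forms. -/
def projMap (r : ℕ) (a : ℤ) (k : ℕ) : HBaseInv r a k →ₗ[ℝ] HOrb r a k :=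
  cohMap (proj r) (proj_intertwines r a) k

/-- The map `[ω] ↦ [ω]` from the cohomology of the `μ_r`-invariant forms on `W^s_1` to
`H^k(W^s_1)`. -/
def inclMap (r : ℕ) (a : ℤ) (k : ℕ) : HBaseInv r a k →ₗ[ℝ] HBase k :=
  forget (atlas 1) (muBase r a) k

end SmallResolution

end

noncomputable section

open Set Topology Function
open scoped LinearAlgebra.Projectivization ContDiff

namespace DeRham

/-! ### Differentiation under the integral sign -/

section ParametricIntegral

variable {E F : Type} [NormedAddCommGroup E] [NormedSpace ℝ E] [FiniteDimensional ℝ E]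
  [NormedAddCommGroup F] [NormedSpace ℝ F]

/-! Each `W r` contracts onto its zero section, a copy of `ℙ¹`, by giving `z` weight 1 and `x`, `y`,
`t` weight `r`. The contraction fixes `[p, q]` and commutes with the group actions. Since `proj r`
maps zero section to zero section identically on `ℙ¹`, the map `zeroSec 1 r` is an equivariant
homotopy inverse of `proj r`: both composites are time-0 ends of contractions. Integration along the
fibres of `ℝ × E → E` gives homotopy operators (`extDeriv_homotopyOp`). They commute with pullback
along every map that commutes with the homotopies (`homotopyOp_natural`), so they preserve invariant
forms, and `projMap_bijective` follows already for the complexes of invariant forms.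

For `inclMap_bijective`, the action of `μ_r` on `W 1` does not move `w`, hence extends to the
connected group `ℂˣ`. Each group element is thus homotopic to the identity, and averaging over the
finite group produces an inverse in cohomology (`forget_bijective`).

The covering statement holds because `W r` is the fibre product of `W 1` with the power map of `ℂ`:
a point of `W r` is a point of `W 1` with a chosen `r`-th root of `w`.

For `H²(W 1)`, a hand-made Mayer–Vietoris argument is used with the two charts, each all of `ℂ³`,
meeting in `ℂˣ × ℂ²`. A closed 2-form has a primitive in each chart. The difference of the
primitives, pulled back to the universal cover `expMap` of the intersection, is `df`, and `f`
changes by a constant under the deck transformation. This period vanishes exactly when the form is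
exact (`HasPeriod.eq_zero_of_exact`, `HasPeriod.exact`), and a form of Fubini–Study type has period
`2π`. So the period identifies `H²(W 1)` with `ℝ`. -/

theorem hasFDerivAt_integral_of_contDiff {G : ℝ × E → F} (hG : ContDiff ℝ 1 G) (v : E) :
    HasFDerivAt (fun v => ∫ t in (0 : ℝ)..1, G (t, v))
      (∫ t in (0 : ℝ)..1, (fderiv ℝ G (t, v)).comp (ContinuousLinearMap.inr ℝ ℝ E)) v := by
  have hc : Continuous fun q : ℝ × E =>
      (fderiv ℝ G q).comp (ContinuousLinearMap.inr ℝ ℝ E) :=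
    (hG.continuous_fderiv one_ne_zero).clm_comp continuous_const
  have : ProperSpace E := FiniteDimensional.proper ℝ E
  -- The constant `C` is the dominating function: the partial derivative is bounded on the compact
  -- set `[0, 1] × closedBall v 1`.
  obtain ⟨C, hC⟩ := (isCompact_Icc (a := (0 : ℝ)) (b := 1)).prod
    (isCompact_closedBall v 1) |>.exists_bound_of_continuousOn hc.continuousOn
  refine intervalIntegral.hasFDerivAt_integral_of_dominated_of_fderiv_le
    (F := fun v t => G (t, v))
    (F' := fun v t => (fderiv ℝ G (t, v)).comp (ContinuousLinearMap.inr ℝ ℝ E))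
    (bound := fun _ => C) (Metric.closedBall_mem_nhds v one_pos) ?_ ?_ ?_ ?_ ?_ ?_
  · exact Filter.Eventually.of_forall fun w =>
      (hG.continuous.comp (by fun_prop)).aestronglyMeasurable
  · exact (hG.continuous.comp (by fun_prop : Continuous fun t : ℝ => (t, v))).intervalIntegrable _ _
  · exact (hc.comp (by fun_prop : Continuous fun t : ℝ => (t, v))).aestronglyMeasurable
  · refine Filter.Eventually.of_forall fun t ht w hw => hC (t, w) ⟨?_, hw⟩
    rw [uIoc_of_le zero_le_one] at ht
    exact Ioc_subset_Icc_self ht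
  · exact intervalIntegrable_const
  · refine Filter.Eventually.of_forall fun t _ w _ => ?_
    have h1 := (hG.differentiable one_ne_zero (t, w)).hasFDerivAt
    exact h1.comp w (hasFDerivAt_prodMk_right t w)

/-- Needed with `A` the alternatization, so that `A` of a derivative is an exterior derivative. -/
theorem clm_fderiv_integral {F' : Type} [NormedAddCommGroup F'] [NormedSpace ℝ F']
    [CompleteSpace F] [CompleteSpace F'] {G : ℝ × E → F} (hG : ContDiff ℝ 1 G)
    (A : (E →L[ℝ] F) →L[ℝ] F') (v : E) :
    A (fderiv ℝ (fun v => ∫ t in (0 : ℝ)..1, G (t, v)) v) =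
      ∫ t in (0 : ℝ)..1, A ((fderiv ℝ G (t, v)).comp (ContinuousLinearMap.inr ℝ ℝ E)) := by
  have hc : Continuous fun q : ℝ × E =>
      (fderiv ℝ G q).comp (ContinuousLinearMap.inr ℝ ℝ E) :=
    (hG.continuous_fderiv one_ne_zero).clm_comp continuous_const
  rw [(hasFDerivAt_integral_of_contDiff hG v).fderiv]
  exact (A.intervalIntegral_comp_comm ((hc.comp
    (by fun_prop : Continuous fun t : ℝ => (t, v))).intervalIntegrable _ _)).symm

/-- The derivative is again a parametric integral, with values in `E →L[ℝ] F`; hence the induction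
quantifies over the target space. -/
theorem contDiff_integral_nat (n : ℕ) : ∀ {F : Type} [NormedAddCommGroup F] [NormedSpace ℝ F]
    {G : ℝ × E → F}, ContDiff ℝ ∞ G → ContDiff ℝ n (fun v => ∫ t in (0 : ℝ)..1, G (t, v)) := by
  induction n with
  | zero =>
    intro F _ _ G hG
    refine contDiff_zero.2 (continuous_iff_continuousAt.2 fun v => ?_)
    exact (hasFDerivAt_integral_of_contDiff (hG.of_le (by simp)) v).continuousAt
  | succ n ih =>
    intro F _ _ G hG
    have hd := hasFDerivAt_integral_of_contDiff (hG.of_le (by simp))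
    refine contDiff_succ_iff_fderiv (n := (n : WithTop ℕ∞)).2
      ⟨fun v => (hd v).differentiableAt, fun h => by simp at h, ?_⟩
    rw [funext fun v => (hd v).fderiv]
    exact ih ((hG.fderiv_right (m := ∞) (by simp)).clm_comp contDiff_const)

theorem contDiff_integral {G : ℝ × E → F} (hG : ContDiff ℝ ∞ G) :
    ContDiff ℝ ∞ (fun v => ∫ t in (0 : ℝ)..1, G (t, v)) :=
  contDiff_infty.2 fun n => contDiff_integral_nat n hG

end ParametricIntegral

/-! ### Fibre integration and homotopy operators on vector spaces -/

section FiberIntegral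

variable {E F E₁ F₁ : Type} [NormedAddCommGroup E] [NormedSpace ℝ E]
  [NormedAddCommGroup F] [NormedSpace ℝ F] [NormedAddCommGroup E₁] [NormedSpace ℝ E₁]
  [NormedAddCommGroup F₁] [NormedSpace ℝ F₁]

/-- Contraction of an alternating form on `ℝ × E` with the unit vector of `ℝ`, restricted
to `E`. -/
def slice (E : Type) [NormedAddCommGroup E] [NormedSpace ℝ E] (k : ℕ) :
    ((ℝ × E) [⋀^Fin (k + 1)]→L[ℝ] ℝ) →L[ℝ] (E [⋀^Fin k]→L[ℝ] ℝ) :=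
  (ContinuousAlternatingMap.compContinuousLinearMapCLM (ContinuousLinearMap.inr ℝ ℝ E)).comp
    ((ContinuousLinearMap.apply ℝ _ ((1 : ℝ), (0 : E))).comp
      (ContinuousAlternatingMap.curryLeftLI (𝕜 := ℝ) (E := ℝ × E)
        (F := ℝ) (n := k)).toContinuousLinearMap)

theorem slice_apply {k : ℕ} (α : (ℝ × E) [⋀^Fin (k + 1)]→L[ℝ] ℝ) (w : Fin k → E) :
    slice E k α w = α (Matrix.vecCons (1, 0) fun i => (0, w i)) := rfl

/-- A 0-form has no contraction, so only the time derivative remains; this is why degree 0 is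
treated separately throughout. -/
theorem slice_alternatizeUncurryFin_zero (L : ℝ × E →L[ℝ] (ℝ × E) [⋀^Fin 0]→L[ℝ] ℝ) :
    slice E 0 (ContinuousAlternatingMap.alternatizeUncurryFin L) =
      (L (1, 0)).compContinuousLinearMap (ContinuousLinearMap.inr ℝ ℝ E) := by
  ext w
  rw [slice_apply, ContinuousAlternatingMap.alternatizeUncurryFin_apply]
  simp only [Fin.sum_univ_succ, Finset.univ_eq_empty, Finset.sum_empty, add_zero]
  simp
  congr 1

/-- Cartan's formula for the vector field `∂/∂t`, at a point. The summand differentiating in the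
direction `(1, 0)` is the time derivative. All others keep `(1, 0)` as first argument, and the shift
of index by one produces the minus sign. -/
theorem slice_alternatizeUncurryFin {k : ℕ}
    (L : ℝ × E →L[ℝ] (ℝ × E) [⋀^Fin (k + 1)]→L[ℝ] ℝ) :
    slice E (k + 1) (ContinuousAlternatingMap.alternatizeUncurryFin L) =
      (L (1, 0)).compContinuousLinearMap (ContinuousLinearMap.inr ℝ ℝ E) -
        ContinuousAlternatingMap.alternatizeUncurryFin
          ((slice E k).comp (L.comp (ContinuousLinearMap.inr ℝ ℝ E))) := by
  ext w
  rw [slice_apply, ContinuousAlternatingMap.alternatizeUncurryFin_apply, Fin.sum_univ_succ,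
    ContinuousAlternatingMap.sub_apply, ContinuousAlternatingMap.alternatizeUncurryFin_apply,
    sub_eq_add_neg, ← Finset.sum_neg_distrib]
  congr 1
  · simp
    rfl
  · refine Finset.sum_congr rfl fun i _ => ?_
    rw [Fin.val_succ, pow_succ, mul_neg_one, neg_smul]
    congr 2
    change _ = slice E k (L (0, w i)) _
    rw [slice_apply]
    change L (0, w i) _ = _
    congr 1
    funext j
    refine Fin.cases ?_ (fun j => ?_) j
    · simp [Fin.removeNth]
    · simp [Fin.removeNth]

/-- The integral over `[0, 1]` of a form on `ℝ × E` along the fibres of the projection to `E`. -/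
def fiberInt {k : ℕ} (α : ℝ × E → (ℝ × E) [⋀^Fin (k + 1)]→L[ℝ] ℝ) (v : E) : E [⋀^Fin k]→L[ℝ] ℝ :=
  ∫ t in (0 : ℝ)..1, slice E k (α (t, v))

theorem contDiff_fiberInt [FiniteDimensional ℝ E] {k : ℕ}
    {α : ℝ × E → (ℝ × E) [⋀^Fin (k + 1)]→L[ℝ] ℝ} (hα : ContDiff ℝ ∞ α) :
    ContDiff ℝ ∞ (fiberInt α) :=
  contDiff_integral (G := fun q => slice E k (α q)) ((slice E k).contDiff.comp hα)

/-- The fundamental theorem of calculus for the restrictions of a form to the slices. -/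
theorem integral_deriv_restrict {k : ℕ} {α : ℝ × E → (ℝ × E) [⋀^Fin k]→L[ℝ] ℝ}
    (hα : ContDiff ℝ ∞ α) (v : E) :
    ∫ t in (0 : ℝ)..1, (fderiv ℝ α (t, v) (1, 0)).compContinuousLinearMap
      (ContinuousLinearMap.inr ℝ ℝ E) =
    (α (1, v)).compContinuousLinearMap (ContinuousLinearMap.inr ℝ ℝ E) -
      (α (0, v)).compContinuousLinearMap (ContinuousLinearMap.inr ℝ ℝ E) := by
  let R := ContinuousAlternatingMap.compContinuousLinearMapCLM (ι := Fin k) (F := ℝ)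
    (ContinuousLinearMap.inr ℝ ℝ E)
  have hc : Continuous fun t : ℝ => R (fderiv ℝ α (t, v) (1, 0)) :=
    R.continuous.comp (((hα.continuous_fderiv (by simp)).comp
      (by fun_prop : Continuous fun t : ℝ => (t, v))).clm_apply continuous_const)
  refine intervalIntegral.integral_eq_sub_of_hasDerivAt (f := fun t => R (α (t, v)))
    (fun t _ => ?_) (hc.intervalIntegrable _ _)
  have h1 : HasFDerivAt α (fderiv ℝ α (t, v)) (t, v) :=
    (hα.differentiable (by simp) (t, v)).hasFDerivAt
  have h2 : HasDerivAt (fun s : ℝ => (s, v)) ((1 : ℝ), (0 : E)) t :=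
    (hasDerivAt_id t).prodMk (hasDerivAt_const t v)
  exact R.hasFDerivAt.comp_hasDerivAt t (h1.comp_hasDerivAt t h2)

theorem fiberInt_extDeriv_zero {α : ℝ × E → (ℝ × E) [⋀^Fin 0]→L[ℝ] ℝ}
    (hα : ContDiff ℝ ∞ α) (v : E) :
    fiberInt (extDeriv α) v =
      (α (1, v)).compContinuousLinearMap (ContinuousLinearMap.inr ℝ ℝ E) -
        (α (0, v)).compContinuousLinearMap (ContinuousLinearMap.inr ℝ ℝ E) := by
  rw [← integral_deriv_restrict hα]
  exact intervalIntegral.integral_congr fun t _ => slice_alternatizeUncurryFin_zero _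

/-- The homotopy formula for integration along the fibres. -/
theorem extDeriv_fiberInt [FiniteDimensional ℝ E] {k : ℕ}
    {α : ℝ × E → (ℝ × E) [⋀^Fin (k + 1)]→L[ℝ] ℝ} (hα : ContDiff ℝ ∞ α) (v : E) :
    extDeriv (fiberInt α) v + fiberInt (extDeriv α) v =
      (α (1, v)).compContinuousLinearMap (ContinuousLinearMap.inr ℝ ℝ E) -
        (α (0, v)).compContinuousLinearMap (ContinuousLinearMap.inr ℝ ℝ E) := by
  have hline : Continuous fun t : ℝ => (t, v) := by fun_prop
  have hdc : Continuous fun t : ℝ => fderiv ℝ α (t, v) :=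
    (hα.continuous_fderiv (by simp)).comp hline
  have hG : ContDiff ℝ ∞ fun q : ℝ × E => slice E k (α q) := (slice E k).contDiff.comp hα
  have hc1 : Continuous fun t : ℝ => (slice E k).comp
      ((fderiv ℝ α (t, v)).comp (ContinuousLinearMap.inr ℝ ℝ E)) :=
    continuous_const.clm_comp (hdc.clm_comp continuous_const)
  have h2 : extDeriv (fiberInt α) v = ∫ t in (0 : ℝ)..1,
      ContinuousAlternatingMap.alternatizeUncurryFin ((slice E k).comp
        ((fderiv ℝ α (t, v)).comp (ContinuousLinearMap.inr ℝ ℝ E))) := by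
    refine (clm_fderiv_integral (hG.of_le (by simp))
      (ContinuousAlternatingMap.alternatizeUncurryFinCLM (n := k) ℝ E ℝ) v).trans ?_
    refine intervalIntegral.integral_congr fun t _ => ?_
    have := (slice E k).hasFDerivAt.comp (t, v) (hα.differentiable (by simp) (t, v)).hasFDerivAt
    rw [show fderiv ℝ (fun q : ℝ × E => slice E k (α q)) (t, v) = _ from this.fderiv]
    rfl
  have hc2 : Continuous fun t : ℝ => ContinuousAlternatingMap.alternatizeUncurryFin
      ((slice E k).comp ((fderiv ℝ α (t, v)).comp (ContinuousLinearMap.inr ℝ ℝ E))) :=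
    (ContinuousAlternatingMap.alternatizeUncurryFinCLM (n := k) ℝ E ℝ).continuous.comp hc1
  have hc3 : Continuous fun t : ℝ => slice E (k + 1) (extDeriv α (t, v)) :=
    (slice E (k + 1)).continuous.comp
      ((ContinuousAlternatingMap.alternatizeUncurryFinCLM (n := k + 1) ℝ (ℝ × E)
        ℝ).continuous.comp hdc)
  rw [h2, fiberInt, ← intervalIntegral.integral_add (hc2.intervalIntegrable _ _)
    (hc3.intervalIntegrable _ _), ← integral_deriv_restrict hα]
  -- By the contraction identity the two alternatizations cancel under the integral, leaving the
  -- time derivative.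
  refine intervalIntegral.integral_congr fun t _ => ?_
  change _ + slice E (k + 1) (ContinuousAlternatingMap.alternatizeUncurryFin _) = _
  rw [slice_alternatizeUncurryFin]
  abel

/-- The homotopy operator on forms associated with the homotopy `Φ`. -/
def homotopyOp {k : ℕ} (Φ : ℝ × E → F) (η : F → F [⋀^Fin (k + 1)]→L[ℝ] ℝ) :
    E → E [⋀^Fin k]→L[ℝ] ℝ :=
  fiberInt (pull Φ η)

theorem contDiff_pull {k : ℕ} {φ : E → F} {η : F → F [⋀^Fin k]→L[ℝ] ℝ}
    (hφ : ContDiff ℝ ∞ φ) (hη : ContDiff ℝ ∞ η) : ContDiff ℝ ∞ (pull φ η) :=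
  contDiff_iff_contDiffAt.2 fun _ => pull_contDiffAt hφ.contDiffAt hη

theorem extDeriv_pull {k : ℕ} {φ : E → F} {η : F → F [⋀^Fin k]→L[ℝ] ℝ}
    (hφ : ContDiff ℝ ∞ φ) (hη : ContDiff ℝ ∞ η) :
    extDeriv (pull φ η) = pull φ (extDeriv η) :=
  funext fun _ => extDeriv_pullback (hη.differentiable (by simp) _) hφ.contDiffAt minSm

theorem contDiff_homotopyOp [FiniteDimensional ℝ E] {k : ℕ} {Φ : ℝ × E → F}
    {η : F → F [⋀^Fin (k + 1)]→L[ℝ] ℝ} (hΦ : ContDiff ℝ ∞ Φ) (hη : ContDiff ℝ ∞ η) :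
    ContDiff ℝ ∞ (homotopyOp Φ η) :=
  contDiff_fiberInt (contDiff_pull hΦ hη)

/-- Turns the boundary terms of fibre integration into pullbacks along the two ends of the homotopy.
-/
theorem pull_restrict {k : ℕ} {Φ : ℝ × E → F} (hΦ : ContDiff ℝ ∞ Φ)
    (η : F → F [⋀^Fin k]→L[ℝ] ℝ) (t : ℝ) (v : E) :
    (pull Φ η (t, v)).compContinuousLinearMap (ContinuousLinearMap.inr ℝ ℝ E) =
      pull (fun v => Φ (t, v)) η v := by
  have h1 := (hΦ.differentiable (by simp) (t, v)).hasFDerivAt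
  have h2 : fderiv ℝ (fun v => Φ (t, v)) v = _ := (h1.comp v (hasFDerivAt_prodMk_right t v)).fderiv
  unfold pull
  rw [h2]
  rfl

theorem homotopyOp_extDeriv_zero {Φ : ℝ × E → F} (hΦ : ContDiff ℝ ∞ Φ)
    {η : F → F [⋀^Fin 0]→L[ℝ] ℝ} (hη : ContDiff ℝ ∞ η) (v : E) :
    homotopyOp Φ (extDeriv η) v =
      pull (fun v => Φ (1, v)) η v - pull (fun v => Φ (0, v)) η v := by
  rw [homotopyOp, ← extDeriv_pull hΦ hη, fiberInt_extDeriv_zero (contDiff_pull hΦ hη),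
    pull_restrict hΦ, pull_restrict hΦ]

theorem extDeriv_homotopyOp [FiniteDimensional ℝ E] {k : ℕ} {Φ : ℝ × E → F}
    (hΦ : ContDiff ℝ ∞ Φ) {η : F → F [⋀^Fin (k + 1)]→L[ℝ] ℝ} (hη : ContDiff ℝ ∞ η) (v : E) :
    extDeriv (homotopyOp Φ η) v + homotopyOp Φ (extDeriv η) v =
      pull (fun v => Φ (1, v)) η v - pull (fun v => Φ (0, v)) η v := by
  rw [homotopyOp, homotopyOp, ← extDeriv_pull hΦ hη, extDeriv_fiberInt (contDiff_pull hΦ hη),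
    pull_restrict hΦ, pull_restrict hΦ]

theorem homotopyOp_zero {k : ℕ} (Φ : ℝ × E → F) (v : E) :
    homotopyOp Φ (0 : F → F [⋀^Fin (k + 1)]→L[ℝ] ℝ) v = 0 := by
  change ∫ t in (0 : ℝ)..1, slice E k
    ((0 : F [⋀^Fin (k + 1)]→L[ℝ] ℝ).compContinuousLinearMap _) = 0
  have h : ∀ t, slice E k ((0 : F [⋀^Fin (k + 1)]→L[ℝ] ℝ).compContinuousLinearMap
      (fderiv ℝ Φ (t, v))) = 0 := fun t => map_zero (slice E k)
  simp [h]

/-- Homotopy operators of homotopies related by maps are related by pullback. -/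
theorem homotopyOp_natural {k : ℕ} {Φ : ℝ × E → E₁} {Ψ : ℝ × F → F₁} {φ : E → F} {ψ : E₁ → F₁}
    {α : E₁ → E₁ [⋀^Fin (k + 1)]→L[ℝ] ℝ} {η : F₁ → F₁ [⋀^Fin (k + 1)]→L[ℝ] ℝ} {v : E}
    (hΦ : ContDiff ℝ ∞ Φ) (hΨ : ContDiff ℝ ∞ Ψ) (hη : ContDiff ℝ ∞ η)
    (hφ : DifferentiableAt ℝ φ v) (hψ : ∀ t, DifferentiableAt ℝ ψ (Φ (t, v)))
    (hc : ∀ t, ∀ᶠ q in 𝓝 (t, v), Ψ (q.1, φ q.2) = ψ (Φ q))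
    (hα : ∀ t, α (Φ (t, v)) = pull ψ η (Φ (t, v))) :
    homotopyOp Φ α v = pull φ (homotopyOp Ψ η) v := by
  -- `Ψ ∘ (id × φ)` and `ψ ∘ Φ` have the same germ at `(t, v)`, hence the same derivative there. The
  -- map `id × φ` preserves the time direction, so the contractions correspond as well.
  have key : ∀ t, slice E k (pull Φ α (t, v)) =
      (slice F k (pull Ψ η (t, φ v))).compContinuousLinearMap (fderiv ℝ φ v) := by
    intro t
    have hΦt := (hΦ.differentiable (by simp) (t, v)).hasFDerivAt
    have hΨt := (hΨ.differentiable (by simp) (t, φ v)).hasFDerivAt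
    have h1 := (hψ t).hasFDerivAt.comp (t, v) hΦt
    have h2 : HasFDerivAt (fun q : ℝ × E => (q.1, φ q.2))
        ((ContinuousLinearMap.fst ℝ ℝ E).prod
          ((fderiv ℝ φ v).comp (ContinuousLinearMap.snd ℝ ℝ E))) (t, v) :=
      hasFDerivAt_fst.prodMk (HasFDerivAt.comp (t, v) hφ.hasFDerivAt hasFDerivAt_snd)
    have h3 := HasFDerivAt.comp (t, v) hΨt h2
    have h4 := h3.unique (h1.congr_of_eventuallyEq (hc t))
    have h5 : Ψ (t, φ v) = ψ (Φ (t, v)) := (hc t).self_of_nhds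
    ext w
    rw [slice_apply]
    change α (Φ (t, v)) _ = (pull Ψ η (t, φ v)) _
    rw [hα]
    change η (ψ (Φ (t, v))) _ = η (Ψ (t, φ v)) _
    rw [h5]
    congr 1
    funext i
    have h6 := fun x : ℝ × E => (congrArg (fun L : ℝ × E →L[ℝ] F₁ => L x) h4).symm
    refine Fin.cases ?_ (fun j => ?_) i
    · have := h6 (1, 0)
      simpa using this
    · have := h6 (0, w j)
      simpa using this
  have hcont : Continuous fun t : ℝ => slice F k (pull Ψ η (t, φ v)) :=
    (slice F k).continuous.comp ((contDiff_pull hΨ hη).continuous.comp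
      (by fun_prop : Continuous fun t : ℝ => (t, φ v)))
  change ∫ t in (0 : ℝ)..1, slice E k (pull Φ α (t, v)) = _
  simp_rw [key]
  -- The derivative of `φ` at `v` does not depend on `t`, so pulling back along it commutes with the
  -- integral.
  exact (ContinuousAlternatingMap.compContinuousLinearMapCLM (ι := Fin k) (F := ℝ)
    (fderiv ℝ φ v)).intervalIntegral_comp_comm (hcont.intervalIntegrable 0 1)

end FiberIntegral

end DeRham

namespace DeRham

/-! ### Homotopy invariance and averaging on manifolds -/

section ChartHomotopy

variable {E F X Y : Type} [NormedAddCommGroup E] [NormedSpace ℝ E]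
  [NormedAddCommGroup F] [NormedSpace ℝ F]
  [TopologicalSpace X] [TopologicalSpace Y] {A : SmoothAtlas E X} {B : SmoothAtlas F Y}

theorem pullback_of_chart (f : SmoothMap A B) {i : A.ι} {j : B.ι} {φ : E → F}
    (h : ∀ v, f (A.param i v) = B.param j (φ v)) {k : ℕ} (α : Form B k) (v : E) :
    (pullback f k α).1 i v = pull φ (α.1 j) v := by
  have hd : v ∈ locDom A B f i j := ⟨φ v, (h v).symm⟩
  rw [pullback_apply f α hd, show locRep A B f i j = φ from funext fun v => locRep_eq_of_eq (h v)]

/-- A smooth homotopy which preserves the charts of an atlas. -/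
structure ChartHomotopy (A : SmoothAtlas E X) where
  /-- the maps of the homotopy -/
  toFun : ℝ → X → X
  /-- the expression of the homotopy in the charts -/
  rep : A.ι → ℝ × E → E
  contDiff_rep : ∀ i, ContDiff ℝ ∞ (rep i)
  apply_param : ∀ i t v, toFun t (A.param i v) = A.param i (rep i (t, v))

namespace ChartHomotopy

/-- For `f` the identity this is the compatibility of the local operators under transition maps, so
that `op` is a global form; for general `f` it gives `pullback_op`. -/
theorem homotopyOp_rep (HA : ChartHomotopy A) (HB : ChartHomotopy B) (f : SmoothMap A B)
    (hf : ∀ t x, f (HA.toFun t x) = HB.toFun t (f x)) {k : ℕ} (η : Form B (k + 1))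
    {i : A.ι} {j : B.ι} {v : E} (hv : v ∈ locDom A B f i j) :
    homotopyOp (HA.rep i) ((pullback f (k + 1) η).1 i) v =
      pull (locRep A B f i j) (homotopyOp (HB.rep j) (η.1 j)) v := by
  have hmem : ∀ t u, u ∈ locDom A B f i j →
      f (A.param i (HA.rep i (t, u))) = B.param j (HB.rep j (t, locRep A B f i j u)) := by
    intro t u hu
    rw [← HA.apply_param, hf, ← HB.apply_param, param_locRep hu]
  refine homotopyOp_natural (HA.contDiff_rep i) (HB.contDiff_rep j) (η.2.1 j)
    ((f.contDiffAt hv).differentiableAt (by simp))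
    (fun t => (f.contDiffAt ⟨_, (hmem t v hv).symm⟩).differentiableAt (by simp))
    (fun t => ?_) (fun t => pullback_apply f η ⟨_, (hmem t v hv).symm⟩)
  have hU := (isOpen_locDom f.continuous_toFun i j).mem_nhds hv
  filter_upwards [continuousAt_snd.preimage_mem_nhds (x := (t, v)) hU] with q hq
  exact (locRep_eq_of_eq (hmem q.1 q.2 hq)).symm

variable [FiniteDimensional ℝ E]

/-- The homotopy operator on differential forms. -/
def op (HA : ChartHomotopy A) {k : ℕ} (η : Form A (k + 1)) : Form A k :=
  ⟨fun i => homotopyOp (HA.rep i) (η.1 i), fun i =>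
    contDiff_homotopyOp (HA.contDiff_rep i) (η.2.1 i), fun i j v hv => by
      have h := homotopyOp_rep HA HA (SmoothMap.id A) (fun _ _ => rfl) η (i := i) (j := j) hv
      rw [pullback_id] at h
      exact h⟩

theorem pullback_op [FiniteDimensional ℝ F] (HA : ChartHomotopy A) (HB : ChartHomotopy B)
    (f : SmoothMap A B)
    (hf : ∀ t x, f (HA.toFun t x) = HB.toFun t (f x)) {k : ℕ} (η : Form B (k + 1)) :
    pullback f k (HB.op η) = HA.op (pullback f (k + 1) η) := by
  apply Subtype.ext
  funext i v
  obtain ⟨j, hj⟩ := B.cover (f (A.param i v))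
  have hj' : v ∈ locDom A B f i j := hj
  rw [pullback_apply f _ hj']
  exact (homotopyOp_rep HA HB f hf η hj').symm

variable (HA : ChartHomotopy A) {f₀ f₁ : SmoothMap A A}

/-- Since the homotopy preserves every chart, the formula on the model space applies chart by chart.
-/
theorem d_op (h₀ : ∀ x, f₀ x = HA.toFun 0 x) (h₁ : ∀ x, f₁ x = HA.toFun 1 x) {k : ℕ}
    (η : Form A (k + 1)) :
    d A k (HA.op η) + HA.op (d A (k + 1) η) =
      pullback f₁ (k + 1) η - pullback f₀ (k + 1) η := by
  apply Subtype.ext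
  funext i v
  change extDeriv (homotopyOp (HA.rep i) (η.1 i)) v +
    homotopyOp (HA.rep i) (extDeriv (η.1 i)) v =
      (pullback f₁ (k + 1) η).1 i v - (pullback f₀ (k + 1) η).1 i v
  rw [extDeriv_homotopyOp (HA.contDiff_rep i) (η.2.1 i),
    pullback_of_chart f₁ (fun v => (h₁ _).trans (HA.apply_param i 1 v)),
    pullback_of_chart f₀ (fun v => (h₀ _).trans (HA.apply_param i 0 v))]

theorem op_d_zero (h₀ : ∀ x, f₀ x = HA.toFun 0 x) (h₁ : ∀ x, f₁ x = HA.toFun 1 x)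
    (η : Form A 0) :
    HA.op (d A 0 η) = pullback f₁ 0 η - pullback f₀ 0 η := by
  apply Subtype.ext
  funext i v
  change homotopyOp (HA.rep i) (extDeriv (η.1 i)) v =
      (pullback f₁ 0 η).1 i v - (pullback f₀ 0 η).1 i v
  rw [homotopyOp_extDeriv_zero (HA.contDiff_rep i) (η.2.1 i),
    pullback_of_chart f₁ (fun v => (h₁ _).trans (HA.apply_param i 1 v)),
    pullback_of_chart f₀ (fun v => (h₀ _).trans (HA.apply_param i 0 v))]

theorem op_zero {k : ℕ} : HA.op (0 : Form A (k + 1)) = 0 :=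
  Subtype.ext (funext fun i => funext fun v => homotopyOp_zero (HA.rep i) v)

/-- Homotopic maps have cohomologous pullbacks. -/
theorem pullback_sub_mem_coboundaries (h₀ : ∀ x, f₀ x = HA.toFun 0 x)
    (h₁ : ∀ x, f₁ x = HA.toFun 1 x) {S : Set (SmoothMap A A)}
    (hS : ∀ g ∈ S, ∀ t x, g (HA.toFun t x) = HA.toFun t (g x)) {k : ℕ} {η : Form A k}
    (hη : η ∈ cocycles A S k) :
    pullback f₁ k η - pullback f₀ k η ∈ coboundaries A S k := by
  have hd : d A k η = 0 := hη.2
  cases k with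
  | zero =>
    -- In degree 0 only the zero form is a coboundary, so the two pullbacks have to be equal.
    rw [← HA.op_d_zero h₀ h₁, hd, op_zero]
    exact zero_mem _
  | succ k =>
    rw [← HA.d_op h₀ h₁, hd, op_zero, add_zero]
    -- The primitive is `S`-invariant because the maps of `S` commute with the homotopy.
    refine ⟨HA.op η, fun g hg => ?_, rfl⟩
    rw [pullback_op HA HA g (hS g hg), hη.1 g hg]

end ChartHomotopy

theorem cls_eq_zero_iff {S : Set (SmoothMap A A)} {k : ℕ} {α : cocycles A S k} :
    cls A S k α = 0 ↔ α.1 ∈ coboundaries A S k :=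
  Submodule.Quotient.mk_eq_zero _

theorem cls_surjective (A : SmoothAtlas E X) (S : Set (SmoothMap A A)) (k : ℕ) :
    Surjective (cls A S k) := Submodule.mkQ_surjective _

/-- A map with a homotopy inverse, compatible with the given sets of maps, induces a bijection
in cohomology. -/
theorem cohMap_bijective {S : Set (SmoothMap A A)} {T : Set (SmoothMap B B)}
    {f : SmoothMap A B} (hf : Intertwines f S T) {g : SmoothMap B A} (hg : Intertwines g T S)
    (k : ℕ)
    (hA : ∀ α ∈ cocycles A S k, α - pullback f k (pullback g k α) ∈ coboundaries A S k)
    (hB : ∀ α ∈ cocycles B T k, α - pullback g k (pullback f k α) ∈ coboundaries B T k) :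
    Bijective (cohMap f hf k) := by
  constructor
  · rw [injective_iff_map_eq_zero]
    intro c hc
    obtain ⟨α, rfl⟩ := cls_surjective B T k c
    rw [cohMap_cls, cls_eq_zero_iff] at hc
    rw [cls_eq_zero_iff]
    -- If `f^*α` is exact then so is `g^*f^*α`, which differs from `α` by a coboundary.
    have h1 := pullback_mem_coboundaries hg hc
    simpa using add_mem (hB α.1 α.2) h1
  · intro c
    obtain ⟨α, rfl⟩ := cls_surjective A S k c
    refine ⟨cls B T k ⟨pullback g k α.1, pullback_mem_cocycles hg α.2⟩, ?_⟩
    rw [cohMap_cls, ← sub_eq_zero, ← map_sub, cls_eq_zero_iff, ← neg_mem_iff]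
    change -(pullback f k (pullback g k α.1) - α.1) ∈ _
    rw [neg_sub]
    exact hA α.1 α.2

/-- If every map of the finite group `G` is homotopic to the identity then the inclusion of
the `G`-invariant forms induces a bijection in cohomology. -/
theorem forget_bijective {G : Type} [Group G] [Fintype G] (ρ : G → SmoothMap B B)
    (hρ : ∀ g h x, ρ g (ρ h x) = ρ (g * h) x) (k : ℕ)
    (hex : ∀ g, ∀ α ∈ cocycles B ∅ k, pullback (ρ g) k α - α ∈ coboundaries B ∅ k) :
    Bijective (forget B (range ρ) k) := by
  have hN : (Fintype.card G : ℝ) ≠ 0 := Nat.cast_ne_zero.2 Fintype.card_ne_zero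
  -- Averaging is a projection onto the invariant forms that commutes with `d`.
  let avg (k : ℕ) (α : Form B k) : Form B k :=
    (Fintype.card G : ℝ)⁻¹ • ∑ g, pullback (ρ g) k α
  have havg : ∀ k (α : Form B k), avg k α ∈ invForm B (range ρ) k := by
    rintro k α _ ⟨g, rfl⟩
    simp only [avg, map_smul, map_sum]
    congr 1
    have h1 : ∀ h, pullback (ρ g) k (pullback (ρ h) k α) = pullback (ρ (h * g)) k α := by
      intro h
      rw [← pullback_comp, pullback_congr (g := ρ (h * g)) (hρ h g)]
    simp_rw [h1]
    exact Fintype.sum_equiv (Equiv.mulRight g) _ _ fun _ => rfl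
  have hd : ∀ k (α : Form B k), d B k (avg k α) = avg (k + 1) (d B k α) := by
    intro k α
    simp only [avg, map_smul, map_sum, d_pullback]
  have hfix : ∀ k, ∀ α ∈ invForm B (range ρ) k, avg k α = α := by
    intro k α hα
    simp only [avg]
    rw [Finset.sum_congr rfl fun g _ => hα (ρ g) ⟨g, rfl⟩, Finset.sum_const, Finset.card_univ,
      ← Nat.cast_smul_eq_nsmul ℝ, smul_smul, inv_mul_cancel₀ hN, one_smul]
  constructor
  · rw [injective_iff_map_eq_zero]
    intro c hc
    obtain ⟨α, rfl⟩ := cls_surjective B _ k c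
    rw [forget_cls, cls_eq_zero_iff] at hc
    rw [cls_eq_zero_iff]
    cases k with
    | zero => exact hc
    | succ k =>
      obtain ⟨η, -, hη⟩ := hc
      -- Averaging an arbitrary primitive of an invariant form gives an invariant primitive.
      refine ⟨avg k η, havg k η, ?_⟩
      rw [hd, show d B k η = α.1 from hη, hfix _ _ α.2.1]
  · intro c
    obtain ⟨α, rfl⟩ := cls_surjective B ∅ k c
    have hcl : d B k (avg k α.1) = 0 := by
      rw [hd, show d B k α.1 = 0 from α.2.2]
      simp [avg]
    refine ⟨cls B _ k ⟨avg k α.1, havg k α.1, hcl⟩, ?_⟩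
    rw [forget_cls, ← sub_eq_zero, ← map_sub, cls_eq_zero_iff]
    change avg k α.1 - α.1 ∈ _
    -- The average differs from `α` by the mean of the coboundaries `ρ_g^*α - α`, so it represents
    -- the same class.
    have h2 : avg k α.1 - α.1 =
        (Fintype.card G : ℝ)⁻¹ • ∑ g, (pullback (ρ g) k α.1 - α.1) := by
      rw [Finset.sum_sub_distrib, Finset.sum_const, Finset.card_univ,
        ← Nat.cast_smul_eq_nsmul ℝ, smul_sub, smul_smul, inv_mul_cancel₀ hN, one_smul]
    rw [h2]
    exact Submodule.smul_mem _ _ (Submodule.sum_mem _ fun g _ => hex g α.1 α.2)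

end ChartHomotopy

end DeRham

namespace SmallResolution

open DeRham

/-! ### Group actions, zero section, contraction and rotation of `W r` -/

section Maps

variable (r : ℕ)

/-- The image stays in the chart and is determined by its chart coordinates. This and `act_paramQ`
show that `rotation` preserves the charts. -/
theorem act_paramP (b c : ℂˣ) (hc : c ^ r = 1) (e : ℂ × ℂ × ℂ) :
    act r b c hc (paramP r e) = paramP r (b * e.1, (b⁻¹ : ℂˣ) * e.2.1, c * e.2.2) := by
  have hm : act r b c hc (paramP r e) ∈ (homeoP r).target := (one_ne_zero : (1 : ℂ) ≠ 0)
  refine ((homeoP r).right_inv hm).symm.trans ?_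
  change paramP r (b * e.1 / 1, _, _) = _
  rw [div_one]
  rfl

theorem act_paramQ (b c : ℂˣ) (hc : c ^ r = 1) (e : ℂ × ℂ × ℂ) :
    act r b c hc (paramQ r e) = paramQ r ((b⁻¹ : ℂˣ) * e.1, b * e.2.1, c * e.2.2) := by
  have hm : act r b c hc (paramQ r e) ∈ (homeoQ r).target := by
    change (b : ℂ) * 1 ≠ 0
    simp
  refine ((homeoQ r).right_inv hm).symm.trans ?_
  change paramQ r (e.1 / (b * 1), _, _) = _
  have h : e.1 / (b * 1) = (b⁻¹ : ℂˣ) * e.1 := by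
    rw [Units.val_inv_eq_inv_val]
    field_simp
  rw [h]
  rfl

theorem act_act (b b' c c' : ℂˣ) (hc : c ^ r = 1) (hc' : c' ^ r = 1) (P : W r) :
    act r b c hc (act r b' c' hc' P) =
      act r (b * b') (c * c') (by rw [mul_pow, hc, hc', one_mul]) P := by
  obtain ⟨⟨⟨x, y, z, t⟩, L⟩, hP⟩ := P
  induction L using Projectivization.ind with
  | h v hv =>
  refine Subtype.ext (Prod.ext (Prod.ext ?_ (Prod.ext ?_ (Prod.ext ?_ rfl))) ?_)
  · change (b : ℂ) * (b' * x) = ((b * b' : ℂˣ) : ℂ) * x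
    push_cast
    ring
  · change ((b⁻¹ : ℂˣ) : ℂ) * ((b'⁻¹ : ℂˣ) * y) = (((b * b')⁻¹ : ℂˣ) : ℂ) * y
    rw [mul_inv]
    push_cast
    ring
  · change (c : ℂ) * (c' * z) = ((c * c' : ℂˣ) : ℂ) * z
    push_cast
    ring
  · refine (Projectivization.mk_eq_mk_iff' ℂ _ _ _ _).2 ⟨1, ?_⟩
    funext i
    fin_cases i
    · change 1 * (((b * b' : ℂˣ) : ℂ) * v 0) = b * (b' * v 0)
      push_cast
      ring
    · exact one_mul _

theorem act_one (P : W r) : act r 1 1 (one_pow r) P = P := by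
  obtain ⟨⟨⟨x, y, z, t⟩, L⟩, hP⟩ := P
  induction L using Projectivization.ind with
  | h v hv =>
  refine Subtype.ext (Prod.ext (Prod.ext ?_ (Prod.ext ?_ (Prod.ext ?_ rfl))) ?_)
  · change ((1 : ℂˣ) : ℂ) * x = x
    simp
  · change ((1⁻¹ : ℂˣ) : ℂ) * y = y
    simp
  · change ((1 : ℂˣ) : ℂ) * z = z
    simp
  · refine (Projectivization.mk_eq_mk_iff' ℂ _ _ _ _).2 ⟨1, ?_⟩
    funext i
    fin_cases i
    · change 1 * v 0 = ((1 : ℂˣ) : ℂ) * v 0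
      simp
    · exact one_mul _

/-- The map `(x, y, z, t, [p, q]) ↦ (0, 0, 0, 0, [p, q])`. -/
def zeroSec (m n : ℕ) (hn : n ≠ 0) : SmoothMap (atlas m) (atlas n) :=
  SmoothMap.ofCharts
    (fun P => ⟨((0, 0, 0, 0), P.1.2), by
      refine ⟨by simp [hn], fun v hv e => ?_⟩
      simp [hn]⟩)
    (by
      have h := continuous_coords m
      exact Continuous.subtype_mk (by fun_prop) _)
    (fun i => i) (fun _ c => (c.1, 0, 0)) (fun _ => by fun_prop) (by
      rintro (_ | _) c
      · refine Subtype.ext (Prod.ext (Prod.ext ?_ (Prod.ext rfl (Prod.ext rfl ?_))) rfl)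
        · change 0 = c.1 * (2 * 0 ^ n - c.1 * 0)
          simp [hn]
        · change 0 = c.1 * 0 - 0 ^ n
          simp [hn]
      · refine Subtype.ext (Prod.ext (Prod.ext rfl (Prod.ext ?_ (Prod.ext rfl ?_))) rfl)
        · change 0 = c.1 * (2 * 0 ^ n - c.1 * 0)
          simp [hn]
        · change 0 = 0 ^ n - c.1 * 0
          simp [hn])

/-- The contraction `(x, y, z, t, [p, q]) ↦ (λ ^ r x, λ ^ r y, λ z, λ ^ r t, [p, q])` of `W r` to
its zero section. -/
def contraction : ChartHomotopy (atlas r) where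
  toFun l P := ⟨((l ^ r * P.1.1.1, l ^ r * P.1.1.2.1, l * P.1.1.2.2.1, l ^ r * P.1.1.2.2.2),
    P.1.2), by
      obtain ⟨h1, h2⟩ := P.2
      -- With the chosen weights the quadric equation scales by `l ^ (2 * r)` and the incidence
      -- equations by `l ^ r`.
      refine ⟨?_, fun v hv e => ⟨?_, ?_⟩⟩
      · rw [mul_pow, mul_comm 2 r, pow_mul, pow_mul, ← pow_mul _ r 2, mul_comm r 2]
        linear_combination ((l : ℂ) ^ r) ^ 2 * h1
      · linear_combination (l : ℂ) ^ r * (h2 v hv e).1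
      · linear_combination (l : ℂ) ^ r * (h2 v hv e).2⟩
  rep _ q := (q.2.1, (q.1 : ℂ) ^ r * q.2.2.1, q.1 * q.2.2.2)
  contDiff_rep _ := by
    have h : ContDiff ℝ ∞ fun q : ℝ × ℂ × ℂ × ℂ => (q.1 : ℂ) :=
      Complex.ofRealCLM.contDiff.comp contDiff_fst
    fun_prop
  apply_param := by
    rintro (_ | _) l c
    · refine Subtype.ext (Prod.ext (Prod.ext ?_ (Prod.ext rfl (Prod.ext rfl ?_))) rfl)
      · change l ^ r * (c.1 * (2 * c.2.2 ^ r - c.1 * c.2.1)) =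
          c.1 * (2 * (l * c.2.2) ^ r - c.1 * (l ^ r * c.2.1))
        ring
      · change l ^ r * (c.1 * c.2.1 - c.2.2 ^ r) = c.1 * (l ^ r * c.2.1) - (l * c.2.2) ^ r
        ring
    · refine Subtype.ext (Prod.ext (Prod.ext rfl (Prod.ext ?_ (Prod.ext rfl ?_))) rfl)
      · change l ^ r * (c.1 * (2 * c.2.2 ^ r - c.1 * c.2.1)) =
          c.1 * (2 * (l * c.2.2) ^ r - c.1 * (l ^ r * c.2.1))
        ring
      · change l ^ r * (c.2.2 ^ r - c.1 * c.2.1) = (l * c.2.2) ^ r - c.1 * (l ^ r * c.2.1)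
        ring

theorem contraction_one (P : W r) : (contraction r).toFun 1 P = P := by
  refine Subtype.ext (Prod.ext (Prod.ext ?_ (Prod.ext ?_ (Prod.ext ?_ ?_))) rfl) <;>
    simp [contraction]

theorem contraction_zero (hr : r ≠ 0) (P : W r) :
    (contraction r).toFun 0 P = zeroSec r r hr P := by
  refine Subtype.ext (Prod.ext (Prod.ext ?_ (Prod.ext ?_ (Prod.ext ?_ ?_))) rfl) <;>
    simp [contraction, hr, zeroSec, SmoothMap.ofCharts]

/-- Both maps are diagonal on `ℂ⁴`, and the contraction does not touch `[p, q]`. This makes the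
contraction usable for invariant forms. -/
theorem act_contraction (b c : ℂˣ) (hc : c ^ r = 1) (l : ℝ) (P : W r) :
    act r b c hc ((contraction r).toFun l P) = (contraction r).toFun l (act r b c hc P) := by
  refine Subtype.ext (Prod.ext (Prod.ext ?_ (Prod.ext ?_ (Prod.ext ?_ rfl))) rfl)
  · exact mul_left_comm _ _ _
  · exact mul_left_comm _ _ _
  · exact mul_left_comm _ _ _

/-- On the zero section only `[p, q]` moves, so the multipliers `c` and `c'` of the third coordinate
may differ: `c = ξ` on `W r` and `c' = 1` on `W 1` match the two actions of `μ_r`. -/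
theorem act_zeroSec (m : ℕ) (hr : r ≠ 0) (b c c' : ℂˣ) (hc : c ^ r = 1) (hc' : c' ^ m = 1)
    (P : W m) :
    act r b c hc (zeroSec m r hr P) = zeroSec m r hr (act m b c' hc' P) :=
  Subtype.ext (Prod.ext (Prod.ext (mul_zero _)
    (Prod.ext (mul_zero _) (Prod.ext (mul_zero _) rfl))) rfl)

/-- Together with `zeroSec_proj` this makes both composites of `proj r` and `zeroSec 1 r` ends of
contractions. -/
theorem proj_zeroSec (m : ℕ) (hr : r ≠ 0) (P : W m) :
    proj r (zeroSec m r hr P) = zeroSec m 1 one_ne_zero P :=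
  Subtype.ext (Prod.ext (Prod.ext rfl (Prod.ext rfl (Prod.ext (zero_pow hr) rfl))) rfl)

theorem zeroSec_proj (m : ℕ) (hm : m ≠ 0) (P : W r) :
    zeroSec 1 m hm (proj r P) = zeroSec r m hm P := rfl

/-- The unit `exp l`. -/
def expUnit (l : ℂ) : ℂˣ := Units.mk0 (Complex.exp l) (Complex.exp_ne_zero l)

/-- The homotopy from the identity to the action of `exp l`. -/
def rotation (l : ℂ) : ChartHomotopy (atlas r) where
  toFun t P := act r (expUnit (t * l)) 1 (one_pow r) P
  rep i q := match i with
    | false => (Complex.exp (q.1 * l) * q.2.1, Complex.exp (-(q.1 * l)) * q.2.2.1, q.2.2.2)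
    | true => (Complex.exp (-(q.1 * l)) * q.2.1, Complex.exp (q.1 * l) * q.2.2.1, q.2.2.2)
  contDiff_rep i := by
    have h : ContDiff ℝ ∞ fun q : ℝ × ℂ × ℂ × ℂ => (q.1 : ℂ) :=
      Complex.ofRealCLM.contDiff.comp contDiff_fst
    have h1 : ContDiff ℝ ∞ fun q : ℝ × ℂ × ℂ × ℂ => Complex.exp (q.1 * l) :=
      (h.mul contDiff_const).cexp
    have h2 : ContDiff ℝ ∞ fun q : ℝ × ℂ × ℂ × ℂ => Complex.exp (-(q.1 * l)) :=
      (h.mul contDiff_const).neg.cexp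
    cases i <;> fun_prop
  apply_param := by
    have hi : ∀ t : ℝ, (((expUnit (t * l))⁻¹ : ℂˣ) : ℂ) = Complex.exp (-(t * l)) := by
      intro t
      rw [Units.val_inv_eq_inv_val, Complex.exp_neg]
      rfl
    rintro (_ | _) t c
    · refine (act_paramP r _ _ _ _).trans ?_
      rw [hi, Units.val_one, one_mul]
      rfl
    · refine (act_paramQ r _ _ _ _).trans ?_
      rw [hi, Units.val_one, one_mul]
      rfl

/-- Writing `b = exp l`, the path `t ↦ exp (t l)` joins `1` to `b` in `ℂˣ`, so the action of `b` is
homotopic to the identity. -/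
theorem pullback_act_sub_mem (b : ℂˣ) {k : ℕ} {η : Form (atlas r) k}
    (hη : η ∈ cocycles (atlas r) ∅ k) :
    pullback (act r b 1 (one_pow r)) k η - η ∈ coboundaries (atlas r) ∅ k := by
  obtain ⟨l, hl⟩ : ∃ l, Complex.exp l = b := ⟨_, Complex.exp_log b.ne_zero⟩
  have hb : expUnit l = b := Units.ext hl
  have h := (rotation r l).pullback_sub_mem_coboundaries (f₀ := SmoothMap.id _)
    (f₁ := act r b 1 (one_pow r)) (fun x => ?_) (fun x => ?_) (S := ∅) (by simp) hη
  · rwa [pullback_id] at h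
  · have h0 : expUnit (((0 : ℝ) : ℂ) * l) = 1 := Units.ext (by simp [expUnit])
    change x = act r (expUnit (((0 : ℝ) : ℂ) * l)) 1 (one_pow r) x
    rw [h0, act_one]
  · have h1 : expUnit (((1 : ℝ) : ℂ) * l) = b := by simp [hb]
    change _ = act r (expUnit (((1 : ℝ) : ℂ) * l)) 1 (one_pow r) x
    rw [h1]

end Maps

/-! ### The isomorphisms in cohomology -/

section Cohomology

variable (r : ℕ) (a : ℤ)

/-- Homotopy invariance for `contraction`, from the zero section at time 0 to the identity at time
1. -/
theorem sub_pullback_zeroSec_mem (hr : r ≠ 0) {S : Set (SmoothMap (atlas r) (atlas r))}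
    (hS : ∀ g ∈ S, ∃ b c hc, g = act r b c hc) {k : ℕ} {η : Form (atlas r) k}
    (hη : η ∈ cocycles (atlas r) S k) :
    η - pullback (zeroSec r r hr) k η ∈ coboundaries (atlas r) S k := by
  have h := (contraction r).pullback_sub_mem_coboundaries (f₀ := zeroSec r r hr)
    (f₁ := SmoothMap.id _) (fun x => (contraction_zero r hr x).symm)
    (fun x => (contraction_one r x).symm) (S := S) ?_ hη
  · rwa [pullback_id] at h
  · intro g hg t x
    obtain ⟨b, c, hc, rfl⟩ := hS g hg
    exact act_contraction r b c hc t x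

theorem muCover_eq_act : ∀ g ∈ muCover r a, ∃ b c hc, g = act r b c hc := by
  rintro _ ⟨ξ, rfl⟩
  exact ⟨_, _, _, rfl⟩

theorem muBase_eq_act : ∀ g ∈ muBase r a, ∃ b c hc, g = act 1 b c hc := by
  rintro _ ⟨ξ, rfl⟩
  exact ⟨_, _, _, rfl⟩

theorem zeroSec_intertwines (hr : r ≠ 0) :
    Intertwines (zeroSec 1 r hr) (muBase r a) (muCover r a) := by
  rintro _ ⟨ξ, rfl⟩
  exact ⟨_, ⟨ξ, rfl⟩, fun x => (act_zeroSec r 1 hr _ _ _ _ _ x).symm⟩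

theorem projMap_bijective (hr : r ≠ 0) (k : ℕ) : Bijective (projMap r a k) := by
  refine cohMap_bijective (proj_intertwines r a) (zeroSec_intertwines r a hr) k ?_ ?_
  · intro α hα
    rw [← pullback_comp, pullback_congr (g := zeroSec r r hr) (zeroSec_proj r r hr)]
    exact sub_pullback_zeroSec_mem r hr (muCover_eq_act r a) hα
  · intro α hα
    rw [← pullback_comp, pullback_congr (g := zeroSec 1 1 one_ne_zero) (proj_zeroSec r 1 hr)]
    exact sub_pullback_zeroSec_mem 1 one_ne_zero (muBase_eq_act r a) hα

theorem inclMap_bijective (hr : r ≠ 0) (k : ℕ) : Bijective (inclMap r a k) := by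
  have : NeZero r := ⟨hr⟩
  have : Fintype (rootsOfUnity r ℂ) := Fintype.ofFinite _
  refine forget_bijective (fun ξ : rootsOfUnity r ℂ => circleAct 1 a ξ.1) (fun ξ ζ x => ?_) k
    fun ξ α hα => pullback_act_sub_mem 1 _ hα
  refine (act_act 1 _ _ _ _ _ _ x).trans ?_
  change _ = act 1 ((ξ.1 * ζ.1) ^ a) 1 _ x
  congr 2
  · rw [mul_zpow]
  · exact one_mul 1

theorem proj_circleAct (ξ : ℂˣ) (P : W r) :
    proj r (circleAct r a ξ P) = circleAct 1 a ξ (proj r P) := by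
  refine Subtype.ext (Prod.ext (Prod.ext rfl (Prod.ext rfl (Prod.ext ?_ rfl))) rfl)
  change (((1 : ℂˣ) : ℂ) * P.1.1.2.2.1) ^ r = ((1 : ℂˣ) : ℂ) * P.1.1.2.2.1 ^ r
  rw [Units.val_one, one_mul, one_mul]

end Cohomology

end SmallResolution

namespace SmallResolution

open DeRham

/-! ### The branched covering -/

section Covering

variable (r : ℕ)

theorem W.continuous_z {r : ℕ} : Continuous (W.z : W r → ℂ) := by
  have h := continuous_coords r
  exact continuous_fst.comp (continuous_snd.comp (continuous_snd.comp (continuous_fst.comp h)))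

theorem continuous_proj : Continuous (proj r) := (proj r).continuous_toFun

/-- The point of `W r` over `Q` whose third coordinate is the given `r`-th root `z` of the third
coordinate of `Q`. -/
def liftRoot (Q : W 1) (z : ℂ) (hz : z ^ r = Q.z) : W r :=
  ⟨((Q.1.1.1, Q.1.1.2.1, z, Q.1.1.2.2.2), Q.1.2), by
    obtain ⟨h1, h2⟩ := Q.2
    have hz' : z ^ r = Q.1.1.2.2.1 := hz
    refine ⟨?_, fun v hv e => ?_⟩
    · rw [← h1]
      change _ - z ^ (2 * r) + _ = _
      rw [mul_comm 2 r, pow_mul, hz', mul_one]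
    · have h3 := h2 v hv e
      rw [pow_one] at h3
      change v 0 * (z ^ r - _) = _ ∧ _ = v 1 * (z ^ r + _)
      rw [hz']
      exact h3⟩

theorem proj_liftRoot (Q : W 1) (z : ℂ) (hz : z ^ r = Q.z) : proj r (liftRoot r Q z hz) = Q :=
  Subtype.ext (Prod.ext (Prod.ext rfl (Prod.ext rfl (Prod.ext hz rfl))) rfl)

theorem W.ext_proj {r : ℕ} {P P' : W r} (h : proj r P = proj r P') (hz : P.z = P'.z) : P = P' := by
  have h1 : (proj r P).1.1.1 = (proj r P').1.1.1 := by rw [h]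
  have h2 : (proj r P).1.1.2.1 = (proj r P').1.1.2.1 := by rw [h]
  have h3 : (proj r P).1.1.2.2.2 = (proj r P').1.1.2.2.2 := by rw [h]
  have h4 : (proj r P).1.2 = (proj r P').1.2 := by rw [h]
  exact Subtype.ext (Prod.ext (Prod.ext h1 (Prod.ext h2 (Prod.ext hz h3))) h4)

theorem proj_z (P : W r) : (proj r P).z = P.z ^ r := rfl

/-- `W r` is the fibre product of `W 1` and `ℂ` over `z ↦ z ^ r`, so a local trivialization `H` of
the power map pulls back to one of `proj r`. -/
theorem isCoveringMapOn_proj (hr : r ≠ 0) : IsCoveringMapOn (proj r) {Q | Q.z ≠ 0} := by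
  intro Q hQ
  have hQ' : Q.z ∈ ({0}ᶜ : Set ℂ) := hQ
  have hcov := isCoveringMapOn_npow (𝕜 := ℂ) r (by exact_mod_cast hr) Q.z hQ'
  obtain ⟨hdisc, U, hQU, hU, hfU, H, hH⟩ := hcov
  refine IsEvenlyCovered.to_isEvenlyCovered_preimage
    (I := (fun x : ℂ => x ^ r) ⁻¹' {Q.z}) ⟨hdisc, W.z ⁻¹' U, hQU, hU.preimage W.continuous_z,
      (hU.preimage W.continuous_z).preimage (continuous_proj r), ?_⟩
  -- The trivialization `H` lies over the power map, so the root it selects in the given sheet is a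
  -- root of the third coordinate.
  have hz : ∀ p : (W.z ⁻¹' U : Set (W 1)) × ((fun x : ℂ => x ^ r) ⁻¹' {Q.z}),
      (H.symm (⟨p.1.1.z, p.1.2⟩, p.2)).1 ^ r = p.1.1.z := by
    intro p
    refine (hH _).symm.trans ?_
    rw [Homeomorph.apply_symm_apply]
  refine ⟨{
    toFun := fun P => (⟨proj r P.1, P.2⟩, (H ⟨P.1.z, P.2⟩).2)
    invFun := fun p => ⟨liftRoot r p.1.1 _ (hz p), by
      change (proj r _).z ∈ U
      rw [proj_liftRoot]
      exact p.1.2⟩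
    left_inv := ?_
    right_inv := ?_
    continuous_toFun := ?_
    continuous_invFun := ?_ }, fun _ => rfl⟩
  · intro P
    refine Subtype.ext (W.ext_proj (proj_liftRoot r _ _
      (hz (⟨proj r P.1, P.2⟩, (H ⟨P.1.z, P.2⟩).2))) ?_)
    change (H.symm (⟨P.1.z ^ r, _⟩, (H ⟨P.1.z, P.2⟩).2)).1 = P.1.z
    have : ((⟨P.1.z ^ r, P.2⟩ : U), (H ⟨P.1.z, P.2⟩).2) = H ⟨P.1.z, P.2⟩ :=
      Prod.ext (Subtype.ext (hH ⟨P.1.z, P.2⟩).symm) rfl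
    rw [this, Homeomorph.symm_apply_apply]
  · intro p
    refine Prod.ext (Subtype.ext (proj_liftRoot r _ _ (hz p))) ?_
    have h := congrArg Prod.snd (H.apply_symm_apply (⟨p.1.1.z, p.1.2⟩, p.2))
    exact h
  · refine Continuous.prodMk (((continuous_proj r).comp continuous_subtype_val).subtype_mk _) ?_
    exact continuous_snd.comp (H.continuous.comp
      ((W.continuous_z.comp continuous_subtype_val).subtype_mk _))
  · refine Continuous.subtype_mk (Continuous.subtype_mk ?_ _) _
    have h1 := (continuous_coords 1).comp (continuous_subtype_val.comp
      (continuous_fst (X := (W.z ⁻¹' U : Set (W 1))) (Y := (fun x : ℂ => x ^ r) ⁻¹' {Q.z})))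
    have h2 : Continuous fun p : (W.z ⁻¹' U : Set (W 1)) × ((fun x : ℂ => x ^ r) ⁻¹' {Q.z}) =>
        (H.symm (⟨p.1.1.z, p.1.2⟩, p.2)).1 := by
      refine continuous_subtype_val.comp (H.symm.continuous.comp (Continuous.prodMk ?_
        continuous_snd))
      exact (W.continuous_z.comp (continuous_subtype_val.comp continuous_fst)).subtype_mk _
    simp only [comp_def] at h1
    fun_prop

/-- The third coordinate identifies the fibre with the `r`-th roots of the nonzero number `Q.z`. -/
theorem ncard_fiber (hr : r ≠ 0) {Q : W 1} (hQ : Q.z ≠ 0) : {P | proj r P = Q}.ncard = r := by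
  have : NeZero r := ⟨hr⟩
  have h1 : W.z '' {P | proj r P = Q} = (Polynomial.nthRootsFinset r Q.z : Set ℂ) := by
    ext z
    rw [Finset.mem_coe, Polynomial.mem_nthRootsFinset (Nat.pos_of_ne_zero hr)]
    constructor
    · rintro ⟨P, rfl, rfl⟩
      rfl
    · intro hz
      exact ⟨liftRoot r Q z hz, proj_liftRoot r Q z hz, rfl⟩
  have h2 : InjOn (W.z (r := r)) {P | proj r P = Q} := fun P hP P' hP' h =>
    W.ext_proj (hP.trans hP'.symm) h
  rw [← h2.ncard_image, h1, ncard_coe_finset]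
  obtain ⟨w, hw⟩ := IsAlgClosed.exists_pow_nat_eq Q.z (Nat.pos_of_ne_zero hr)
  have hprim := Complex.isPrimitiveRoot_exp r hr
  rw [Polynomial.nthRootsFinset, Multiset.toFinset_card_of_nodup]
  · have := hprim.card_nthRoots Q.z
    rw [this, if_pos ⟨w, hw⟩]
  · exact hprim.nthRoots_nodup hQ

theorem existsUnique_fiber (hr : r ≠ 0) {Q : W 1} (hQ : Q.z = 0) : ∃! P, proj r P = Q := by
  refine ⟨liftRoot r Q 0 (by rw [hQ, zero_pow hr]), proj_liftRoot r _ _ _, fun P hP => ?_⟩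
  refine W.ext_proj (hP.trans (proj_liftRoot r _ _ _).symm) ?_
  have h : P.z ^ r = 0 := by rw [← proj_z, hP, hQ]
  exact eq_zero_of_pow_eq_zero h

end Covering

end SmallResolution

namespace DeRham

/-! ### The Poincaré lemma on a vector space -/

section FormsOnVectorSpaces

variable {E F G : Type} [NormedAddCommGroup E] [NormedSpace ℝ E] [NormedAddCommGroup F]
  [NormedSpace ℝ F] [NormedAddCommGroup G] [NormedSpace ℝ G]

theorem pull_pull {k : ℕ} {φ : E → F} {ψ : F → G} (α : G → G [⋀^Fin k]→L[ℝ] ℝ) {v : E}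
    (hψ : DifferentiableAt ℝ ψ (φ v)) (hφ : DifferentiableAt ℝ φ v) :
    pull φ (pull ψ α) v = pull (ψ ∘ φ) α v := by
  unfold pull
  rw [fderiv_comp v hψ hφ]
  rfl

theorem pull_congr {k : ℕ} {φ ψ : E → F} (α : F → F [⋀^Fin k]→L[ℝ] ℝ) {v : E}
    (h : φ =ᶠ[𝓝 v] ψ) : pull φ α v = pull ψ α v := by
  unfold pull
  rw [h.fderiv_eq, h.eq_of_nhds]

theorem pull_id {k : ℕ} (α : E → E [⋀^Fin k]→L[ℝ] ℝ) (v : E) : pull (fun v => v) α v = α v := by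
  unfold pull
  rw [fderiv_fun_id]
  rfl

theorem pull_const {k : ℕ} (w : F) (α : F → F [⋀^Fin (k + 1)]→L[ℝ] ℝ) (v : E) :
    pull (fun _ : E => w) α v = 0 := by
  unfold pull
  rw [fderiv_fun_const]
  ext u
  exact (α w).map_coord_zero 0 rfl

theorem contDiff_sub_pi {f g : E → F} (hf : ContDiff ℝ ∞ f) (hg : ContDiff ℝ ∞ g) :
    ContDiff ℝ ∞ (f - g) := hf.sub hg

theorem contDiff_smul_pi {f : E → F} (hf : ContDiff ℝ ∞ f) (t : ℝ) : ContDiff ℝ ∞ (t • f) :=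
  hf.const_smul t

theorem extDeriv_sub {k : ℕ} {α β : E → E [⋀^Fin k]→L[ℝ] ℝ} (hα : ContDiff ℝ ∞ α)
    (hβ : ContDiff ℝ ∞ β) : extDeriv (α - β) = extDeriv α - extDeriv β := by
  funext v
  have hα' := hα.differentiable (by simp) v
  have hβ' := hβ.differentiable (by simp) v
  change ContinuousAlternatingMap.alternatizeUncurryFinCLM ℝ E ℝ (fderiv ℝ (α - β) v) = _
  rw [fderiv_sub hα' hβ', map_sub]
  rfl

/-- A function as a differential form of degree `0`. -/
def ofFun (f : E → ℝ) (v : E) : E [⋀^Fin 0]→L[ℝ] ℝ :=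
  ContinuousAlternatingMap.constOfIsEmpty ℝ E (Fin 0) (f v)

theorem contDiff_ofFun {f : E → ℝ} (hf : ContDiff ℝ ∞ f) : ContDiff ℝ ∞ (ofFun f) :=
  (ContinuousAlternatingMap.constOfIsEmptyLIE ℝ E ℝ (Fin 0)).contDiff.comp hf

theorem eq_ofFun (α : E → E [⋀^Fin 0]→L[ℝ] ℝ) : α = ofFun fun v => α v ![] := by
  funext v
  ext w
  change α v w = α v ![]
  rw [Subsingleton.elim w ![]]

/-- The differential of a function. -/
def dFun (f : E → ℝ) : E → E [⋀^Fin 1]→L[ℝ] ℝ := extDeriv (ofFun f)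

theorem pull_dFun {φ : E → F} {f : F → ℝ} (hφ : ContDiff ℝ ∞ φ) (hf : ContDiff ℝ ∞ f) :
    pull φ (dFun f) = dFun (f ∘ φ) :=
  (extDeriv_pull hφ (contDiff_ofFun hf)).symm

theorem contDiff_extDeriv {k : ℕ} {α : E → E [⋀^Fin k]→L[ℝ] ℝ} (hα : ContDiff ℝ ∞ α) :
    ContDiff ℝ ∞ (extDeriv α) := by
  have h := hα.fderiv_right (m := ∞) (by simp)
  exact (ContinuousAlternatingMap.alternatizeUncurryFinCLM ℝ E ℝ).contDiff.comp h

theorem contDiff_dFun {f : E → ℝ} (hf : ContDiff ℝ ∞ f) : ContDiff ℝ ∞ (dFun f) :=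
  contDiff_extDeriv (contDiff_ofFun hf)

theorem extDeriv_dFun {f : E → ℝ} (hf : ContDiff ℝ ∞ f) : extDeriv (dFun f) = 0 :=
  extDeriv_extDeriv (contDiff_ofFun hf) minSm

theorem dFun_sub {f g : E → ℝ} (hf : ContDiff ℝ ∞ f) (hg : ContDiff ℝ ∞ g) :
    dFun (f - g) = dFun f - dFun g := by
  rw [dFun, dFun, dFun, ← extDeriv_sub (contDiff_ofFun hf) (contDiff_ofFun hg)]
  rfl

theorem contDiff_scaling : ContDiff ℝ ∞ fun q : ℝ × E => q.1 • q.2 :=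
  contDiff_fst.smul contDiff_snd

/-- The Poincaré lemma. -/
theorem exists_extDeriv_eq [FiniteDimensional ℝ E] {k : ℕ} {α : E → E [⋀^Fin (k + 1)]→L[ℝ] ℝ}
    (hα : ContDiff ℝ ∞ α) (hd : extDeriv α = 0) :
    ∃ β : E → E [⋀^Fin k]→L[ℝ] ℝ, ContDiff ℝ ∞ β ∧ extDeriv β = α := by
  -- The primitive comes from the homotopy `(t, v) ↦ t • v`; its end at `t = 0` is constant and
  -- kills forms of positive degree.
  refine ⟨_, contDiff_homotopyOp contDiff_scaling hα, funext fun v => ?_⟩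
  have h := extDeriv_homotopyOp (contDiff_scaling (E := E)) hα v
  rw [hd, homotopyOp_zero] at h
  simpa [pull_const, pull_id] using h

theorem exists_dFun_eq [FiniteDimensional ℝ E] {α : E → E [⋀^Fin 1]→L[ℝ] ℝ}
    (hα : ContDiff ℝ ∞ α) (hd : extDeriv α = 0) :
    ∃ f : E → ℝ, ContDiff ℝ ∞ f ∧ dFun f = α := by
  obtain ⟨β, hβ, h⟩ := exists_extDeriv_eq hα hd
  refine ⟨fun v => β v ![], ?_, by rw [dFun, ← eq_ofFun, h]⟩
  have e : (fun v => β v ![]) =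
      (ContinuousAlternatingMap.constOfIsEmptyLIE ℝ E ℝ (Fin 0)).symm ∘ β :=
    funext fun v => congrArg (β v) (Subsingleton.elim _ _)
  rw [e]
  exact (ContinuousAlternatingMap.constOfIsEmptyLIE ℝ E ℝ (Fin 0)).symm.contDiff.comp hβ

/-- The degree-0 homotopy formula for scaling compares the value at any point with the value at the
origin. -/
theorem eq_of_dFun_eq_zero {f : E → ℝ} (hf : ContDiff ℝ ∞ f) (hd : dFun f = 0) (v w : E) :
    f v = f w := by
  have key : ∀ v, f v = f 0 := by
    intro v
    have h := homotopyOp_extDeriv_zero (contDiff_scaling (E := E)) (contDiff_ofFun hf) v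
    rw [show extDeriv (ofFun f) = 0 from hd, homotopyOp_zero] at h
    have h2 := congrArg (fun α : E [⋀^Fin 0]→L[ℝ] ℝ => α ![]) h
    change 0 = f ((1 : ℝ) • v) - f ((0 : ℝ) • v) at h2
    rw [one_smul, zero_smul] at h2
    linarith
  rw [key v, key w]

end FormsOnVectorSpaces

end DeRham

namespace SmallResolution

open DeRham

/-- The model space of the charts. -/
abbrev Model : Type := ℂ × ℂ × ℂ

/-! ### Gluing forms from the two charts of `W 1` -/

section Gluing

/-- The covering `(σ, u, z) ↦ (exp σ, u, z)` of the intersection of the two charts. -/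
def expMap (c : Model) : Model := (Complex.exp c.1, c.2.1, c.2.2)

/-- The map `expMap` in the coordinates of the other chart. -/
def expMap' (c : Model) : Model :=
  (Complex.exp (-c.1), Complex.exp c.1 * (2 * c.2.2 - Complex.exp c.1 * c.2.1), c.2.2)

theorem contDiff_expMap : ContDiff ℝ ∞ expMap :=
  (contDiff_fst.cexp).prodMk contDiff_snd

theorem contDiff_expMap' : ContDiff ℝ ∞ expMap' := by
  have h : ContDiff ℝ ∞ fun c : Model => Complex.exp c.1 := contDiff_fst.cexp
  have h' : ContDiff ℝ ∞ fun c : Model => Complex.exp (-c.1) := contDiff_fst.neg.cexp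
  unfold expMap'
  fun_prop

theorem trans_expMap (c : Model) : trans 1 (expMap c) = expMap' c := by
  simp only [trans, expMap, expMap', Complex.exp_neg, pow_one]

theorem trans_trans {c : Model} (hc : c.1 ≠ 0) : trans 1 (trans 1 c) = c := by
  obtain ⟨s, u, z⟩ := c
  have hs : s ≠ 0 := hc
  simp only [trans, pow_one, inv_inv, Prod.mk.injEq, true_and, and_true]
  field_simp
  ring

theorem isOpen_fst_ne : IsOpen {c : Model | c.1 ≠ 0} := isOpen_ne.preimage continuous_fst

theorem contDiffAt_trans {c : Model} (hc : c.1 ≠ 0) : ContDiffAt ℝ ∞ (trans 1) c :=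
  (contDiffOn_trans 1).contDiffAt (isOpen_fst_ne.mem_nhds hc)

/-- The local inverse of `expMap` near `c`. -/
def logMap (c e : Model) : Model := (Complex.log c.1 + Complex.log (e.1 / c.1), e.2.1, e.2.2)

theorem contDiffAt_logMap {c : Model} (hc : c.1 ≠ 0) : ContDiffAt ℝ ∞ (logMap c) c := by
  have h1 : ContDiffAt ℝ ∞ (fun e : Model => e.1 / c.1) c := contDiffAt_fst.div_const _
  have h2 : ContDiffAt ℝ ∞ (fun e : Model => Complex.log (e.1 / c.1)) c :=
    -- At the base point the quotient is 1, which lies in the slit plane wherever `c` is.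
    ((Complex.contDiffAt_log (by rw [div_self hc]; exact Complex.one_mem_slitPlane)).restrict_scalars
      ℝ).comp c h1
  exact (contDiffAt_const.add h2).prodMk contDiffAt_snd

theorem expMap_logMap {c e : Model} (hc : c.1 ≠ 0) (he : e.1 ≠ 0) :
    expMap (logMap c e) = e := by
  refine Prod.ext ?_ rfl
  change Complex.exp (Complex.log c.1 + Complex.log (e.1 / c.1)) = e.1
  rw [Complex.exp_add, Complex.exp_log hc, Complex.exp_log (div_ne_zero he hc)]
  field_simp

variable {k : ℕ} {α₀ α₁ : Model → Model [⋀^Fin k]→L[ℝ] ℝ}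

theorem pull_expMap (h : ∀ c : Model, c.1 ≠ 0 → α₀ c = pull (trans 1) α₁ c) :
    pull expMap α₀ = pull expMap' α₁ := by
  funext c
  have hc : (expMap c).1 ≠ 0 := Complex.exp_ne_zero _
  have h1 : pull expMap α₀ c = pull expMap (pull (trans 1) α₁) c := by
    unfold pull
    rw [h _ hc]
    rfl
  rw [h1, pull_pull α₁ ((contDiffAt_trans hc).differentiableAt (by simp))
    (contDiff_expMap.differentiable (by simp) c), show trans 1 ∘ expMap = expMap' from
    funext trans_expMap]

/-- `expMap` has a local section `logMap c` near each point of the intersection, so an identity of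
forms may be tested on the cover. -/
theorem eq_pull_trans (h : pull expMap α₀ = pull expMap' α₁) {c : Model} (hc : c.1 ≠ 0) :
    α₀ c = pull (trans 1) α₁ c := by
  have hU := isOpen_fst_ne.mem_nhds hc
  have hl := (contDiffAt_logMap hc).differentiableAt (by simp)
  have h1 : pull (expMap ∘ logMap c) α₀ c = α₀ c := by
    refine (pull_congr α₀ ?_).trans (pull_id α₀ c)
    filter_upwards [hU] with e he using expMap_logMap hc he
  have h2 : pull (expMap' ∘ logMap c) α₁ c = pull (trans 1) α₁ c := by
    refine pull_congr α₁ ?_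
    filter_upwards [hU] with e he
    rw [comp_apply, ← trans_expMap, expMap_logMap hc he]
  rw [← h1, ← h2, ← pull_pull _ (contDiff_expMap.differentiable (by simp) _) hl, h,
    pull_pull _ (contDiff_expMap'.differentiable (by simp) _) hl]

/-- The transition map is an involution where the first coordinate is nonzero. -/
theorem eq_pull_trans_symm (h : ∀ c : Model, c.1 ≠ 0 → α₀ c = pull (trans 1) α₁ c) {c : Model}
    (hc : c.1 ≠ 0) : α₁ c = pull (trans 1) α₀ c := by
  have hc' : (trans 1 c).1 ≠ 0 := inv_ne_zero hc
  have h1 : pull (trans 1) α₀ c = pull (trans 1) (pull (trans 1) α₁) c := by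
    unfold pull
    rw [h _ hc']
    rfl
  rw [h1, pull_pull α₁ ((contDiffAt_trans hc').differentiableAt (by simp))
    ((contDiffAt_trans hc).differentiableAt (by simp))]
  refine ((pull_congr α₁ ?_).trans (pull_id α₁ c)).symm
  filter_upwards [isOpen_fst_ne.mem_nhds hc] with e he using trans_trans he

theorem invFun_param {i j : Bool} {c e : Model} (h : param 1 i c = param 1 j e) :
    invFun (param 1 j) (param 1 i c) = e := by
  rw [h]
  exact leftInverse_invFun (isOpenEmbedding_param 1 j).injective e

theorem pull_transition_self (i : Bool) (α : Model → Model [⋀^Fin k]→L[ℝ] ℝ) (c : Model) :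
    pull (invFun (param 1 i) ∘ param 1 i) α c = α c := by
  rw [show invFun (param 1 i) ∘ param 1 i = fun c => c from funext fun c => invFun_param rfl,
    pull_id]

theorem pull_transition (α : Model → Model [⋀^Fin k]→L[ℝ] ℝ) {c : Model} (hc : c.1 ≠ 0) :
    pull (invFun (param 1 true) ∘ param 1 false) α c = pull (trans 1) α c := by
  refine pull_congr α ?_
  filter_upwards [isOpen_fst_ne.mem_nhds hc] with e he using invFun_param (paramP_eq 1 he)

theorem pull_transition' (α : Model → Model [⋀^Fin k]→L[ℝ] ℝ) {c : Model} (hc : c.1 ≠ 0) :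
    pull (invFun (param 1 false) ∘ param 1 true) α c = pull (trans 1) α c := by
  refine pull_congr α ?_
  filter_upwards [isOpen_fst_ne.mem_nhds hc] with e he using invFun_param (paramQ_eq 1 he)

theorem pull_expMap_form (η : Form (atlas 1) k) :
    pull expMap (η.1 false) = pull expMap' (η.1 true) := by
  refine pull_expMap fun c hc => ?_
  exact (η.2.2 false true c (paramP_mem 1 |>.2 hc)).trans (pull_transition _ hc)

/-- Forms in the two charts which agree on the intersection define a form. -/
theorem exists_form (h₀ : ContDiff ℝ ∞ α₀) (h₁ : ContDiff ℝ ∞ α₁)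
    (h : pull expMap α₀ = pull expMap' α₁) :
    ∃ η : Form (atlas 1) k, η.1 false = α₀ ∧ η.1 true = α₁ := by
  have h2 : ∀ c : Model, c.1 ≠ 0 → α₀ c = pull (trans 1) α₁ c := fun c => eq_pull_trans h
  refine ⟨⟨fun i => match i with
    | false => α₀
    | true => α₁, ?_, ?_⟩, rfl, rfl⟩
  · rintro (_ | _)
    · exact h₀
    · exact h₁
  · rintro (_ | _) (_ | _) c hc
    · exact (pull_transition_self false α₀ c).symm
    · have hc' : c.1 ≠ 0 := (paramP_mem 1).1 hc
      exact (h2 c hc').trans (pull_transition α₁ hc').symm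
    · have hc' : c.1 ≠ 0 := (paramQ_mem 1).1 hc
      exact (eq_pull_trans_symm h2 hc').trans (pull_transition' α₀ hc').symm
    · exact (pull_transition_self true α₁ c).symm

end Gluing

end SmallResolution

namespace SmallResolution

open DeRham

/-! ### The period of a closed 2-form and the dimension of `H²` -/

section Period

/-- The deck transformation of `expMap`. -/
def shift (c : Model) : Model := (c.1 + 2 * Real.pi * Complex.I, c.2)

theorem contDiff_shift : ContDiff ℝ ∞ shift :=
  (contDiff_fst.add contDiff_const).prodMk contDiff_snd

theorem expMap_shift (c : Model) : expMap (shift c) = expMap c := by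
  refine Prod.ext ?_ rfl
  exact Complex.exp_periodic c.1

theorem expMap'_shift (c : Model) : expMap' (shift c) = expMap' c := by
  rw [← trans_expMap, expMap_shift, trans_expMap]

/-- The closed form `η` is exact in both charts, and the difference of the primitives has the
period `c` around the intersection of the charts. -/
def HasPeriod (η : Form (atlas 1) 2) (c : ℝ) : Prop :=
  ∃ (α₀ α₁ : Model → Model [⋀^Fin 1]→L[ℝ] ℝ) (f : Model → ℝ), ContDiff ℝ ∞ α₀ ∧ ContDiff ℝ ∞ α₁ ∧
    ContDiff ℝ ∞ f ∧ extDeriv α₀ = η.1 false ∧ extDeriv α₁ = η.1 true ∧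
    dFun f = pull expMap α₀ - pull expMap' α₁ ∧ ∀ e, f (shift e) = f e + c

/-- The Poincaré lemma gives primitives in both charts, and `f` exists because their difference is
closed on the cover, a vector space. That difference is invariant under `shift`, so `f ∘ shift - f`
has zero differential and is constant. -/
theorem exists_hasPeriod {η : Form (atlas 1) 2} (hη : d (atlas 1) 2 η = 0) :
    ∃ c, HasPeriod η c := by
  have hd : ∀ i, extDeriv (η.1 i) = 0 := fun i => congrFun (congrArg Subtype.val hη) i
  obtain ⟨α₀, h₀, hα₀⟩ := exists_extDeriv_eq (η.2.1 false) (hd false)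
  obtain ⟨α₁, h₁, hα₁⟩ := exists_extDeriv_eq (η.2.1 true) (hd true)
  have hp₀ := contDiff_pull contDiff_expMap h₀
  have hp₁ := contDiff_pull contDiff_expMap' h₁
  have hcl : extDeriv (pull expMap α₀ - pull expMap' α₁) = 0 := by
    rw [extDeriv_sub hp₀ hp₁, extDeriv_pull contDiff_expMap h₀, extDeriv_pull contDiff_expMap' h₁,
      hα₀, hα₁, pull_expMap_form, sub_self]
  obtain ⟨f, hf, hdf⟩ := exists_dFun_eq (contDiff_sub_pi hp₀ hp₁) hcl
  have hs : ContDiff ℝ ∞ (f ∘ shift) := hf.comp contDiff_shift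
  have hinv : pull shift (dFun f) = dFun f := by
    rw [hdf]
    funext v
    change pull shift (pull expMap α₀) v - pull shift (pull expMap' α₁) v = _
    rw [pull_pull _ (contDiff_expMap.differentiable (by simp) _)
        (contDiff_shift.differentiable (by simp) _),
      pull_pull _ (contDiff_expMap'.differentiable (by simp) _)
        (contDiff_shift.differentiable (by simp) _),
      show expMap ∘ shift = expMap from funext expMap_shift,
      show expMap' ∘ shift = expMap' from funext expMap'_shift]
    rfl
  have h0 : dFun (f ∘ shift - f) = 0 := by
    rw [dFun_sub hs hf, ← pull_dFun contDiff_shift hf, hinv, sub_self]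
  refine ⟨(f ∘ shift - f) 0, α₀, α₁, f, h₀, h₁, hf, hα₀, hα₁, hdf, fun e => ?_⟩
  have := eq_of_dFun_eq_zero (hs.sub hf) h0 e 0
  change f (shift e) - f e = f (shift 0) - f 0 at this
  change f (shift e) = f e + (f (shift 0) - f 0)
  linarith

theorem pull_sub_smul {E F : Type} [NormedAddCommGroup E] [NormedSpace ℝ E]
    [NormedAddCommGroup F] [NormedSpace ℝ F] {k : ℕ} (φ : E → F)
    (α β : F → F [⋀^Fin k]→L[ℝ] ℝ) (t : ℝ) :
    pull φ (α - t • β) = pull φ α - t • pull φ β := rfl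

theorem HasPeriod.sub_smul {η ζ : Form (atlas 1) 2} {b c : ℝ} (hη : HasPeriod η b)
    (hζ : HasPeriod ζ c) (t : ℝ) : HasPeriod (η - t • ζ) (b - t * c) := by
  obtain ⟨α₀, α₁, f, h₀, h₁, hf, hα₀, hα₁, hdf, hp⟩ := hη
  obtain ⟨β₀, β₁, g, k₀, k₁, hg, hβ₀, hβ₁, hdg, hq⟩ := hζ
  have hd : ∀ {k : ℕ} {α β : Model → Model [⋀^Fin k]→L[ℝ] ℝ}, ContDiff ℝ ∞ α → ContDiff ℝ ∞ β →
      extDeriv (α - t • β) = extDeriv α - t • extDeriv β := by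
    intro k α β hα hβ
    rw [extDeriv_sub hα (contDiff_smul_pi hβ t)]
    funext v
    change _ - extDeriv (t • β) v = _
    rw [extDeriv_smul]
    rfl
  refine ⟨α₀ - t • β₀, α₁ - t • β₁, f - t • g, h₀.sub (k₀.const_smul t), h₁.sub (k₁.const_smul t),
    hf.sub (hg.const_smul t), ?_, ?_, ?_, fun e => ?_⟩
  · rw [hd h₀ k₀, hα₀, hβ₀]
    rfl
  · rw [hd h₁ k₁, hα₁, hβ₁]
    rfl
  · rw [pull_sub_smul, pull_sub_smul]
    have h2 : dFun (f - t • g) = dFun f - t • dFun g := hd (contDiff_ofFun hf) (contDiff_ofFun hg)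
    rw [h2, hdf, hdg, smul_sub]
    abel
  · change f (shift e) - t * g (shift e) = f e - t * g e + (b - t * c)
    rw [hp, hq]
    ring

/-- The chart primitives differ from a global one by `dg₀` and `dg₁`. So `f` is `g₀ ∘ expMap - g₁ ∘
expMap'` up to a constant, which is invariant under `shift`. -/
theorem HasPeriod.eq_zero_of_exact {η : Form (atlas 1) 2} {c : ℝ} (hη : HasPeriod η c)
    {ζ : Form (atlas 1) 1} (hζ : d (atlas 1) 1 ζ = η) : c = 0 := by
  obtain ⟨α₀, α₁, f, h₀, h₁, hf, hα₀, hα₁, hdf, hp⟩ := hη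
  subst hζ
  have key : ∀ i α, ContDiff ℝ ∞ α → extDeriv α = extDeriv (ζ.1 i) →
      ∃ g : Model → ℝ, ContDiff ℝ ∞ g ∧ dFun g = α - ζ.1 i := by
    intro i α hα h
    refine exists_dFun_eq (contDiff_sub_pi hα (ζ.2.1 i)) ?_
    rw [extDeriv_sub hα (ζ.2.1 i), h, sub_self]
  obtain ⟨g₀, hg₀, hd₀⟩ := key false α₀ h₀ hα₀
  obtain ⟨g₁, hg₁, hd₁⟩ := key true α₁ h₁ hα₁
  have hs₀ : ContDiff ℝ ∞ (g₀ ∘ expMap) := hg₀.comp contDiff_expMap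
  have hs₁ : ContDiff ℝ ∞ (g₁ ∘ expMap') := hg₁.comp contDiff_expMap'
  have h : dFun (f - (g₀ ∘ expMap - g₁ ∘ expMap')) = 0 := by
    rw [dFun_sub hf (contDiff_sub_pi hs₀ hs₁), dFun_sub hs₀ hs₁, ← pull_dFun contDiff_expMap hg₀,
      ← pull_dFun contDiff_expMap' hg₁, hd₀, hd₁, hdf]
    have e₀ : pull expMap (α₀ - ζ.1 false) = pull expMap α₀ - pull expMap (ζ.1 false) := rfl
    have e₁ : pull expMap' (α₁ - ζ.1 true) = pull expMap' α₁ - pull expMap' (ζ.1 true) := rfl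
    rw [e₀, e₁, pull_expMap_form]
    abel
  have h1 := eq_of_dFun_eq_zero (hf.sub (hs₀.sub hs₁)) h (shift 0) 0
  change f (shift 0) - (g₀ (expMap (shift 0)) - g₁ (expMap' (shift 0))) =
    f 0 - (g₀ (expMap 0) - g₁ (expMap' 0)) at h1
  rw [expMap_shift, expMap'_shift, hp] at h1
  linarith

/-- A smooth function of `s` which vanishes near `0` and takes values with sum `1` at `s`
and `s⁻¹`. -/
def cutoff (s : ℂ) : ℝ :=
  Real.smoothTransition (3 * (Complex.normSq s / (1 + Complex.normSq s)) - 1)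

theorem contDiff_normSq : ContDiff ℝ ∞ Complex.normSq := by
  have h1 : ContDiff ℝ ∞ Complex.re := Complex.reCLM.contDiff
  have h2 : ContDiff ℝ ∞ Complex.im := Complex.imCLM.contDiff
  exact (h1.mul h1).add (h2.mul h2)

theorem one_add_normSq_pos (s : ℂ) : 0 < 1 + Complex.normSq s := by
  have := Complex.normSq_nonneg s
  positivity

theorem contDiff_cutoff : ContDiff ℝ ∞ cutoff := by
  refine Real.smoothTransition.contDiff.comp (ContDiff.sub (contDiff_const.mul
    (contDiff_normSq.div (contDiff_const.add contDiff_normSq) fun s => ?_)) contDiff_const)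
  exact (one_add_normSq_pos s).ne'

theorem cutoff_eventuallyEq_zero : ∀ᶠ s in 𝓝 (0 : ℂ), cutoff s = 0 := by
  have h : ContinuousAt (fun s : ℂ => 3 * (Complex.normSq s / (1 + Complex.normSq s)) - 1) 0 := by
    have := contDiff_normSq.continuous
    refine Continuous.continuousAt (Continuous.sub (continuous_const.mul
      (this.div (continuous_const.add this) fun s => (one_add_normSq_pos s).ne')) continuous_const)
  have h2 := h.eventually_lt (continuousAt_const (y := (0 : ℝ))) (by norm_num)
  filter_upwards [h2] with s hs using Real.smoothTransition.zero_of_nonpos hs.le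

theorem smoothTransition_add (x : ℝ) :
    Real.smoothTransition x + Real.smoothTransition (1 - x) = 1 := by
  have h := (Real.smoothTransition.pos_denom x).ne'
  unfold Real.smoothTransition
  rw [sub_sub_cancel, add_comm (expNegInvGlue (1 - x)), ← add_div, div_self h]

theorem cutoff_add_cutoff_inv {s : ℂ} (hs : s ≠ 0) : cutoff s + cutoff s⁻¹ = 1 := by
  have hn : Complex.normSq s ≠ 0 := fun h => hs (Complex.normSq_eq_zero.1 h)
  have h := (one_add_normSq_pos s).ne'
  have h' : Complex.normSq s + 1 ≠ 0 := by rwa [add_comm] at h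
  -- With `x = |s|² / (1 + |s|²)`, inversion sends `x` to `1 - x`. The map `x ↦ 3 x - 1` carries the
  -- symmetric interval `[1/3, 2/3]` to `[0, 1]`, where the transition takes place.
  have e : 3 * (Complex.normSq s⁻¹ / (1 + Complex.normSq s⁻¹)) - 1 =
      1 - (3 * (Complex.normSq s / (1 + Complex.normSq s)) - 1) := by
    rw [Complex.normSq_inv]
    field_simp
    ring
  rw [cutoff, cutoff, e, smoothTransition_add]

/-- Extends a function smooth on the intersection of the charts to a whole chart, since the cutoff
vanishes near `s = 0`. -/
theorem contDiff_cutoff_mul {g : Model → ℝ} (hg : ∀ c : Model, c.1 ≠ 0 → ContDiffAt ℝ ∞ g c) :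
    ContDiff ℝ ∞ fun c : Model => cutoff c.1 * g c := by
  refine contDiff_iff_contDiffAt.2 fun c => ?_
  by_cases hc : c.1 = 0
  · refine (contDiffAt_const (c := (0 : ℝ))).congr_of_eventuallyEq ?_
    have h : Filter.Tendsto (fun e : Model => e.1) (𝓝 c) (𝓝 0) := by
      rw [← hc]
      exact continuousAt_fst
    filter_upwards [h.eventually cutoff_eventuallyEq_zero] with e he
    rw [he, zero_mul]
  · exact (contDiff_cutoff.contDiffAt.comp c contDiffAt_fst).mul (hg c hc)

/-- The descended function uses the principal logarithm. Periodicity makes the choice of branch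
irrelevant, so smoothness across the cut can be checked with the branch `logMap c`. -/
theorem exists_of_periodic {f : Model → ℝ} (hf : ContDiff ℝ ∞ f) (hp : ∀ e, f (shift e) = f e) :
    ∃ g : Model → ℝ, (∀ c : Model, c.1 ≠ 0 → ContDiffAt ℝ ∞ g c) ∧ ∀ e, g (expMap e) = f e := by
  have hg : ∀ e, f (Complex.log (expMap e).1, (expMap e).2) = f e := by
    intro e
    have hper : Periodic (fun σ : ℂ => f (σ, e.2)) (2 * Real.pi * Complex.I) := fun σ => hp (σ, e.2)
    obtain ⟨n, hn⟩ := Complex.exp_eq_exp_iff_exists_int.1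
      (Complex.exp_log (Complex.exp_ne_zero e.1))
    change f (Complex.log (Complex.exp e.1), e.2) = _
    rw [hn]
    exact hper.int_mul n e.1
  refine ⟨fun c => f (Complex.log c.1, c.2), fun c hc => ?_, hg⟩
  refine (hf.contDiffAt.comp c (contDiffAt_logMap hc)).congr_of_eventuallyEq ?_
  filter_upwards [isOpen_fst_ne.mem_nhds hc] with e he
  have h := hg (logMap c e)
  rwa [expMap_logMap hc he] at h

/-- With period 0, `f` descends to a function on the intersection, which the cutoff splits as a
difference of functions `g₀`, `g₁` on the two charts. The corrected primitives `α₀ - dg₀` and `α₁ -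
dg₁` then agree and glue. -/
theorem HasPeriod.exact {η : Form (atlas 1) 2} (hη : HasPeriod η 0) :
    ∃ ζ, d (atlas 1) 1 ζ = η := by
  obtain ⟨α₀, α₁, f, h₀, h₁, hf, hα₀, hα₁, hdf, hp⟩ := hη
  obtain ⟨g, hg, hgf⟩ := exists_of_periodic hf fun e => by rw [hp, add_zero]
  have hg' : ∀ c : Model, c.1 ≠ 0 → ContDiffAt ℝ ∞ (g ∘ trans 1) c := fun c hc =>
    (hg _ (inv_ne_zero hc)).comp c (contDiffAt_trans hc)
  have hs₀ := contDiff_cutoff_mul hg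
  have hs₁ := (contDiff_cutoff_mul hg').neg
  set g₀ : Model → ℝ := fun c => cutoff c.1 * g c with hg₀
  set g₁ : Model → ℝ := fun c => -(cutoff c.1 * (g ∘ trans 1) c) with hg₁
  have hfg : f = g₀ ∘ expMap - g₁ ∘ expMap' := by
    funext e
    have hne : (expMap e).1 ≠ 0 := Complex.exp_ne_zero _
    change f e = cutoff (expMap e).1 * g (expMap e) -
      -(cutoff (expMap' e).1 * g (trans 1 (expMap' e)))
    rw [← trans_expMap, trans_trans hne, hgf]
    change _ = cutoff (expMap e).1 * f e - -(cutoff (expMap e).1⁻¹ * f e)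
    -- The weights at `s` and `s⁻¹` add up to 1.
    linear_combination -f e * cutoff_add_cutoff_inv hne
  have hd : pull expMap (α₀ - dFun g₀) = pull expMap' (α₁ - dFun g₁) := by
    have e₀ : pull expMap (α₀ - dFun g₀) = pull expMap α₀ - pull expMap (dFun g₀) := rfl
    have e₁ : pull expMap' (α₁ - dFun g₁) = pull expMap' α₁ - pull expMap' (dFun g₁) := rfl
    rw [e₀, e₁, pull_dFun contDiff_expMap hs₀, pull_dFun contDiff_expMap' hs₁, ← sub_eq_zero,
      sub_sub_sub_comm, ← hdf, ← dFun_sub (hs₀.comp contDiff_expMap) (hs₁.comp contDiff_expMap'),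
      ← hfg, sub_self]
  have hsm : ∀ {α : Model → Model [⋀^Fin 1]→L[ℝ] ℝ} {g : Model → ℝ}, ContDiff ℝ ∞ α →
      ContDiff ℝ ∞ g → ContDiff ℝ ∞ (α - dFun g) ∧ extDeriv (α - dFun g) = extDeriv α := by
    intro α g hα hg
    refine ⟨hα.sub (contDiff_dFun hg), ?_⟩
    rw [extDeriv_sub hα (contDiff_dFun hg), extDeriv_dFun hg, sub_zero]
  obtain ⟨ζ, hζ₀, hζ₁⟩ := exists_form (hsm h₀ hs₀).1 (hsm h₁ hs₁).1 hd
  refine ⟨ζ, Subtype.ext (funext fun i => ?_)⟩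
  change extDeriv (ζ.1 i) = η.1 i
  cases i
  · rw [hζ₀, (hsm h₀ hs₀).2, hα₀]
  · rw [hζ₁, (hsm h₁ hs₁).2, hα₁]

/-- The real linear map `(σ, u, z) ↦ Re (b σ)` as a constant form. -/
def reForm (b : ℂ) : Model [⋀^Fin 1]→L[ℝ] ℝ :=
  ContinuousAlternatingMap.ofSubsingleton ℝ Model ℝ (0 : Fin 1)
    (Complex.reCLM.comp ((ContinuousLinearMap.mul ℝ ℂ b).comp (ContinuousLinearMap.fst ℝ ℂ (ℂ × ℂ))))

theorem reForm_apply (b : ℂ) (w : Fin 1 → Model) : reForm b w = (b * (w 0).1).re := rfl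

/-- The form `Im (s̄ ds) / (1 + |s| ^ 2)`. -/
def potential (c : Model) : Model [⋀^Fin 1]→L[ℝ] ℝ :=
  (c.1.re / (1 + Complex.normSq c.1)) • reForm (-Complex.I) -
    (c.1.im / (1 + Complex.normSq c.1)) • reForm 1

theorem contDiff_potential : ContDiff ℝ ∞ potential := by
  have h1 : ContDiff ℝ ∞ fun c : Model => c.1.re := Complex.reCLM.contDiff.comp contDiff_fst
  have h2 : ContDiff ℝ ∞ fun c : Model => c.1.im := Complex.imCLM.contDiff.comp contDiff_fst
  have h3 : ContDiff ℝ ∞ fun c : Model => 1 + Complex.normSq c.1 :=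
    contDiff_const.add (contDiff_normSq.comp contDiff_fst)
  have h4 : ∀ c : Model, 1 + Complex.normSq c.1 ≠ 0 := fun c => (one_add_normSq_pos c.1).ne'
  exact ((h1.div h3 h4).smul contDiff_const).sub ((h2.div h3 h4).smul contDiff_const)

theorem potential_apply (c : Model) (w : Fin 1 → Model) :
    potential c w = (c.1.re * (w 0).1.im - c.1.im * (w 0).1.re) / (1 + Complex.normSq c.1) := by
  change c.1.re / (1 + Complex.normSq c.1) * reForm (-Complex.I) w -
    c.1.im / (1 + Complex.normSq c.1) * reForm 1 w = _
  rw [reForm_apply, reForm_apply]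
  simp
  ring

theorem fderiv_expMap_fst (c w : Model) :
    (fderiv ℝ expMap c w).1 = Complex.exp c.1 * w.1 := by
  have h := ((contDiff_expMap.differentiable (by simp) c).hasFDerivAt.fst).unique
    ((hasFDerivAt_fst (𝕜 := ℝ) (p := c)).cexp)
  exact congrArg (fun L : Model →L[ℝ] ℂ => L w) h

theorem fderiv_expMap'_fst (c w : Model) :
    (fderiv ℝ expMap' c w).1 = Complex.exp (-c.1) * -w.1 := by
  have h := ((contDiff_expMap'.differentiable (by simp) c).hasFDerivAt.fst).unique
    ((hasFDerivAt_fst (𝕜 := ℝ) (p := c)).neg.cexp)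
  exact congrArg (fun L : Model →L[ℝ] ℂ => L w) h

/-- For `s = exp σ` with angle `θ = Im σ`, the potential is `|s|² / (1 + |s|²) dθ` in one chart and
`-1 / (1 + |s|²) dθ` in the other, so the difference is `dθ`. -/
theorem pull_potential_sub :
    dFun (fun c : Model => c.1.im) = pull expMap potential - pull expMap' potential := by
  funext c
  ext w
  have h1 : dFun (fun c : Model => c.1.im) c w = (w 0).1.im := by
    rw [dFun]
    unfold ofFun
    rw [extDeriv_constOfIsEmpty]
    have h : HasFDerivAt (fun c : Model => c.1.im)
        (Complex.imCLM.comp (ContinuousLinearMap.fst ℝ ℂ (ℂ × ℂ))) c :=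
      Complex.imCLM.hasFDerivAt.comp c hasFDerivAt_fst
    rw [h.fderiv]
    rfl
  rw [h1]
  change _ = potential (expMap c) (fun i => fderiv ℝ expMap c (w i)) -
    potential (expMap' c) (fun i => fderiv ℝ expMap' c (w i))
  rw [potential_apply, potential_apply, fderiv_expMap_fst, fderiv_expMap'_fst]
  change _ = ((Complex.exp c.1).re * _ - (Complex.exp c.1).im * _) /
    (1 + Complex.normSq (Complex.exp c.1)) - ((Complex.exp (-c.1)).re * _ -
      (Complex.exp (-c.1)).im * _) / (1 + Complex.normSq (Complex.exp (-c.1)))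
  have hn : Complex.normSq (Complex.exp c.1) ≠ 0 := fun h =>
    Complex.exp_ne_zero _ (Complex.normSq_eq_zero.1 h)
  have e1 : ∀ s x : ℂ, s.re * (s * x).im - s.im * (s * x).re = Complex.normSq s * x.im := by
    intro s x
    rw [Complex.normSq_apply, Complex.mul_re, Complex.mul_im]
    ring
  rw [e1, e1, Complex.exp_neg, Complex.normSq_inv, Complex.neg_im]
  have h := (one_add_normSq_pos (Complex.exp c.1)).ne'
  have h' : Complex.normSq (Complex.exp c.1) + 1 ≠ 0 := by rwa [add_comm] at h
  field_simp
  ring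

/-- The differentials of the two potentials glue because the potentials differ by the closed form `d
(Im σ)`; the period is the increase of `Im σ` under `shift`. -/
theorem exists_hasPeriod_two_pi :
    ∃ η : Form (atlas 1) 2, d (atlas 1) 2 η = 0 ∧ HasPeriod η (2 * Real.pi) := by
  have hp := contDiff_potential
  have hf : ContDiff ℝ ∞ fun c : Model => c.1.im := Complex.imCLM.contDiff.comp contDiff_fst
  have h : pull expMap (extDeriv potential) = pull expMap' (extDeriv potential) := by
    rw [← extDeriv_pull contDiff_expMap hp, ← extDeriv_pull contDiff_expMap' hp, ← sub_eq_zero,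
      ← extDeriv_sub (contDiff_pull contDiff_expMap hp) (contDiff_pull contDiff_expMap' hp),
      ← pull_potential_sub, extDeriv_dFun hf]
  obtain ⟨η, h₀, h₁⟩ := exists_form (contDiff_extDeriv hp) (contDiff_extDeriv hp) h
  refine ⟨η, Subtype.ext (funext fun i => ?_), potential, potential, _, hp, hp, hf, h₀.symm,
    h₁.symm, pull_potential_sub, fun e => ?_⟩
  · change extDeriv (η.1 i) = 0
    cases i
    · rw [h₀, extDeriv_extDeriv hp minSm]
    · rw [h₁, extDeriv_extDeriv hp minSm]
  · change (e.1 + 2 * Real.pi * Complex.I).im = _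
    simp

theorem finrank_HBase_two : Module.finrank ℝ (HBase 2) = 1 := by
  obtain ⟨ζ, hζ, hper⟩ := exists_hasPeriod_two_pi
  have hcoc : ∀ η : Form (atlas 1) 2, d (atlas 1) 2 η = 0 → η ∈ cocycles (atlas 1) ∅ 2 :=
    fun η hη => ⟨fun _ hg => absurd hg (notMem_empty _), hη⟩
  have h2pi : 2 * Real.pi ≠ 0 := by positivity
  refine finrank_eq_one_iff_of_nonzero' (cls (atlas 1) ∅ 2 ⟨ζ, hcoc ζ hζ⟩) (fun h => ?_) |>.2
    fun c => ?_
  · obtain ⟨θ, -, hθ⟩ := cls_eq_zero_iff.1 h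
    exact h2pi (hper.eq_zero_of_exact hθ)
  · obtain ⟨η, rfl⟩ := cls_surjective (atlas 1) ∅ 2 c
    obtain ⟨b, hb⟩ := exists_hasPeriod (show d (atlas 1) 2 η.1 = 0 from η.2.2)
    -- This multiple of the reference form has the same period `b`, so the difference has period 0
    -- and is exact.
    have h := hb.sub_smul hper (b / (2 * Real.pi))
    rw [div_mul_cancel₀ _ h2pi, sub_self] at h
    obtain ⟨θ, hθ⟩ := h.exact
    refine ⟨b / (2 * Real.pi), ?_⟩
    rw [← map_smul, eq_comm, ← sub_eq_zero, ← map_sub, cls_eq_zero_iff]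
    exact ⟨θ, fun _ hg => absurd hg (notMem_empty _), hθ⟩

end Period

end SmallResolution

end

theorem proposition3p2p2 (r : ℕ) (hr : 1 ≤ r) (a : ℤ) (ha : IsCoprime a (r : ℤ)) :
    -- the projection is an `r`-fold covering away from `w = 0`, and one-to-one over `w = 0`
    IsCoveringMapOn (SmallResolution.proj r) {Q | Q.z ≠ 0} ∧
    (∀ Q : SmallResolution.W 1, Q.z ≠ 0 → {P | SmallResolution.proj r P = Q}.ncard = r) ∧
    (∀ Q : SmallResolution.W 1, Q.z = 0 → ∃! P, SmallResolution.proj r P = Q) ∧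
    -- it is equivariant for the actions of `μ_r` and of the circle
    (∀ (ξ : rootsOfUnity r ℂ) (P : SmallResolution.W r),
      SmallResolution.proj r (SmallResolution.muAct r a ξ P) =
        SmallResolution.circleAct 1 a ξ.1 (SmallResolution.proj r P)) ∧
    (∀ (ξ : Circle) (P : SmallResolution.W r),
      SmallResolution.proj r (SmallResolution.circleAct r a (Circle.toUnits ξ) P) =
        SmallResolution.circleAct 1 a (Circle.toUnits ξ) (SmallResolution.proj r P)) ∧
    -- it induces an isomorphism from the cohomology of `W^s_1` to that of `W^s_r`
    (∀ k : ℕ,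
      Function.Bijective (SmallResolution.inclMap r a k) ∧
      Function.Bijective (SmallResolution.projMap r a k) ∧
      ∃ Φ : SmallResolution.HBase k ≃ₗ[ℝ] SmallResolution.HOrb r a k,
        ∀ c : SmallResolution.HBaseInv r a k,
          Φ (SmallResolution.inclMap r a k c) = SmallResolution.projMap r a k c) ∧
    -- and `H^2(W^s_r)` is one-dimensional
    Module.finrank ℝ (SmallResolution.HOrb r a 2) = 1 := by
  have hr' : r ≠ 0 := Nat.one_le_iff_ne_zero.1 hr
  let Φ (k : ℕ) : SmallResolution.HBase k ≃ₗ[ℝ] SmallResolution.HOrb r a k :=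
    (LinearEquiv.ofBijective _ (SmallResolution.inclMap_bijective r a hr' k)).symm.trans
      (LinearEquiv.ofBijective _ (SmallResolution.projMap_bijective r a hr' k))
  refine ⟨SmallResolution.isCoveringMapOn_proj r hr',
    fun Q hQ => SmallResolution.ncard_fiber r hr' hQ,
    fun Q hQ => SmallResolution.existsUnique_fiber r hr' hQ,
    SmallResolution.proj_muAct r a,
    fun ξ P => SmallResolution.proj_circleAct r a _ P,
    fun k => ⟨SmallResolution.inclMap_bijective r a hr' k,
      SmallResolution.projMap_bijective r a hr' k, Φ k, fun c => ?_⟩,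
    (Φ 2).finrank_eq.symm.trans SmallResolution.finrank_HBase_two⟩
  exact congrArg (SmallResolution.projMap r a k)
    ((LinearEquiv.ofBijective _ (SmallResolution.inclMap_bijective r a hr' k)).symm_apply_apply c)
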